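/- Let $d\in\mathbb N$, let $\mathcal R\subset\mathbb Z^d$ be finite and nonempty, $\mathcal G\subset\mathbb Z^d$ the additive group generated by $\mathcal R$, and $\mathcal U\subset\mathbb R^d$ the convex hull of $\mathcal R$. Let $P$ be the law (with expectation $E$) of the random walk $X_k=Z_1+\dots+Z_k$, $X_0=0$, whose steps $Z_i$ are independent and uniform on $\mathcal R$. Let $(\Omega,\mathfrak S,\mathbb P)$ be a probability space with measurable maps $T_x:\Omega\to\Omega$, $x\in\mathcal G$, that preserve $\mathbb P$ and satisfy $T_{x+y}=T_xT_y$ and $T_0=\mathrm{id}$. Fix an integer $\ell\ge 0$ and write $Z_{i,j}=(Z_i,\dots,Z_j)$. A function $g:\Omega\times\mathcal R^\ell\to\mathbb R$ belongs to the class $\mathcal L$ if for each $\tilde z\in\mathcal R^\ell$ one has $g(\cdot,\tilde z)\in L^1(\mathbb P)$ and, for every nonzero $z\in\mathcal R$ and $\mathbb P$-a.e. $\omega$, $$\varlimsup_{\varepsilon\searrow0}\ \varlimsup_{n\to\infty}\ \max_{x\in\mathcal G:\,|x|\le n}\ \frac1n\sum_{0\le k\le\varepsilon n}\bigl|g(T_{x+kz}\omega,\tilde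 z)\bigr|=0 .$$ For $\zeta\in\mathcal U$, an admissible approximating sequence is $\hat x_n(\zeta)=\sum_{z\in\mathcal R}\bigl(\lfloor n\beta_z\rfloor+b_z^{(n)}\bigr)z$, $n\ge 0$, where $\beta_z\in[0,1]$, $\sum_z\beta_z=1$, $\sum_z\beta_z z=\zeta$, all $\beta_z$ are rational if $\zeta\in\mathbb Q^d$, and $b_z^{(n)}\in\{0,1\}$ satisfy $b_z^{(n)}=0$ whenever $\beta_z=0$ and $\sum_z b_z^{(n)}=n-\sum_z\lfloor n\beta_z\rfloor$. **Theorem.** Let $g\in\mathcal L$ and let $\mathcal U_0$ be a face of $\mathcal U$ (possibly $\mathcal U$ itself), that is, a convex subset such that every closed segment in $\mathcal U$ with a relative interior point in $\mathcal U_0$ has both endpoints in $\mathcal U_0$. Suppose that $\mathbb P$ is ergodic under $\{T_z:z\in\mathcal R\cap\mathcal U_0\}$, that is, every $A\in\mathfrak S$ with $T_z^{-1}A=A$ for all $z\in\mathcal R\cap\mathcal U_0$ has $\mathbb P(A)\in\{0,1\}$. Then there exist a nonrandom function $\zeta\mapsto\Lambda_\ell(g,\zeta)\in(-\infty,\infty]$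 on the relative interior $\mathrm{ri}\,\mathcal U_0$ and an event $\Omega_0\in\mathfrak S$ with $\mathbb P(\Omega_0)=1$ such that for all $\omega\in\Omega_0$, all $\zeta\in\mathrm{ri}\,\mathcal U_0$, and every admissible approximating sequence $\hat x_n(\zeta)$, $$\lim_{n\to\infty}\frac1n\log E\Bigl[e^{\sum_{k=0}^{n-1}g(T_{X_k}\omega,\,Z_{k+1,k+\ell})}\,\mathbf 1\{X_n=\hat x_n(\zeta)\}\Bigr]=\Lambda_\ell(g,\zeta).$$ -/

import Mathlib

open MeasureTheory Filter Topology

noncomputable section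

namespace RWRP

variable {d : ℕ}

/-- A lattice point of `ℤ^d` viewed as a point of Euclidean space `ℝ^d`. -/
def toReal (x : Fin d → ℤ) : EuclideanSpace ℝ (Fin d) :=
  WithLp.toLp 2 fun i => (x i : ℝ)

/-- The additive subgroup `𝒢` of `ℤ^d` generated by the finite set `R` of admissible steps. -/
abbrev StepGroup (R : Finset (Fin d → ℤ)) : AddSubgroup (Fin d → ℤ) :=
  AddSubgroup.closure (R : Set (Fin d → ℤ))

/-- An admissible step as an element of the group `𝒢`. -/
def step {R : Finset (Fin d → ℤ)} (z : R) : StepGroup R :=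
  ⟨z, AddSubgroup.subset_closure z.2⟩

/-- The convex hull `𝒰` in `ℝ^d` of the set of admissible steps. -/
def stepHull (R : Finset (Fin d → ℤ)) : Set (EuclideanSpace ℝ (Fin d)) :=
  convexHull ℝ (toReal '' (R : Set (Fin d → ℤ)))

/-- `F` is a face of `C`: a convex subset such that every segment in `C` with a relative interior
point in `F` has both endpoints in `F`. -/
def IsFace (C F : Set (EuclideanSpace ℝ (Fin d))) : Prop :=
  Convex ℝ F ∧ IsExtreme ℝ C F

/-! ### The random walk -/

/-- The law of the sequence of steps `(Z_{i+1})_{i ≥ 0}` of the random walk: independent steps,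
each uniform on `R`. -/
def stepLaw (R : Finset (Fin d → ℤ)) [Nonempty R] : Measure (ℕ → R) :=
  Measure.infinitePi fun _ : ℕ => (PMF.uniformOfFintype R).toMeasure

/-- The position `X_k = Z_1 + ⋯ + Z_k` of the walk started at `0`, where `s i = Z_{i+1}`. -/
def position {R : Finset (Fin d → ℤ)} (s : ℕ → R) (k : ℕ) : StepGroup R :=
  ∑ i ∈ Finset.range k, step (s i)

/-- The vector of steps `Z_{k+1,k+ℓ} = (Z_{k+1}, …, Z_{k+ℓ})`. -/
def stepBlock {R : Finset (Fin d → ℤ)} (ℓ : ℕ) (s : ℕ → R) (k : ℕ) : Fin ℓ → R :=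
  fun j => s (k + j)

section Environment

variable {R : Finset (Fin d → ℤ)} {Ω : Type*} [AddAction (StepGroup R) Ω]

/-- The energy `∑_{k=0}^{n-1} g(T_{X_k} ω, Z_{k+1,k+ℓ})` of a path; the shift `T_x ω` is written
`x +ᵥ ω`. -/
def energy {ℓ : ℕ} (g : Ω × (Fin ℓ → R) → ℝ) (ω : Ω) (n : ℕ) (s : ℕ → R) : ℝ :=
  ∑ k ∈ Finset.range n, g (position s k +ᵥ ω, stepBlock ℓ s k)

/-- The point-to-point partition function
`E[exp (∑_{k=0}^{n-1} g(T_{X_k} ω, Z_{k+1,k+ℓ})) 𝟙{X_n = x}]`. -/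
def ptpPartition [Nonempty R] {ℓ : ℕ} (g : Ω × (Fin ℓ → R) → ℝ) (ω : Ω) (n : ℕ)
    (x : Fin d → ℤ) : ENNReal :=
  ∫⁻ s, Set.indicator {s : ℕ → R | (position s n : Fin d → ℤ) = x}
    (fun s => ENNReal.ofReal (Real.exp (energy g ω n s))) s ∂(stepLaw R)

/-- `n⁻¹ log E[exp (∑_{k=0}^{n-1} g(T_{X_k} ω, Z_{k+1,k+ℓ})) 𝟙{X_n = x}]`, with
`log 0 = -∞`. -/
def ptpFreeEnergy [Nonempty R] {ℓ : ℕ} (g : Ω × (Fin ℓ → R) → ℝ) (ω : Ω) (n : ℕ)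
    (x : Fin d → ℤ) : EReal :=
  ENNReal.log (ptpPartition g ω n x) / (n : EReal)

variable [MeasurableSpace Ω]

/-- The class `𝓛` of potentials `g : Ω × R^ℓ → ℝ`: for each `z' ∈ R^ℓ`, `g(·, z')` is in `L¹(P)`
and, for each nonzero `z ∈ R`, almost surely
`limsup_{ε ↘ 0} limsup_{n → ∞} max_{x ∈ 𝒢, |x| ≤ n} n⁻¹ ∑_{0 ≤ k ≤ ε n} |g(T_{x + k z} ω, z')| = 0`.
-/
def InClassL (P : Measure Ω) {ℓ : ℕ} (g : Ω × (Fin ℓ → R) → ℝ) : Prop :=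
  ∀ z' : Fin ℓ → R,
    Integrable (fun ω => g (ω, z')) P ∧
    ∀ z : R, (z : Fin d → ℤ) ≠ 0 →
      ∀ᵐ ω ∂P,
        limsup (fun ε : ℝ =>
          limsup (fun n : ℕ =>
            ⨆ x : {x : StepGroup R // ‖toReal (x : Fin d → ℤ)‖ ≤ n},
              (∑ k ∈ Finset.range (⌊ε * n⌋₊ + 1),
                ‖g ((x.1 + k • step z) +ᵥ ω, z')‖ₑ) / (n : ENNReal)) atTop)
          (𝓝[>] (0 : ℝ)) = 0

/-- `P` is ergodic under the shifts `{T_z : z ∈ S}`: every event `A` with `T_z⁻¹ A = A` for all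
`z ∈ S` has probability `0` or `1`. -/
def ErgodicUnder (P : Measure Ω) (S : Set (StepGroup R)) : Prop :=
  ∀ A : Set Ω, MeasurableSet A → (∀ z ∈ S, (fun ω => z +ᵥ ω) ⁻¹' A = A) → P A = 0 ∨ P A = 1

end Environment

/-! ### The lattice points `x̂_n(ζ)` -/

/-- `β` and `b` are admissible choices in the definition of `x̂_n(ζ)`: `β` is a vector of weights
of a convex representation `ζ = ∑_z β_z z`, rational when `ζ` is rational, and the numbers
`b n z ∈ {0,1}` vanish where `β z = 0` and satisfy `∑_z b n z = n - ∑_z ⌊n β_z⌋`. -/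
structure IsApproxData (R : Finset (Fin d → ℤ)) (ζ : EuclideanSpace ℝ (Fin d))
    (β : R → ℝ) (b : ℕ → R → ℤ) : Prop where
  weight_mem : ∀ z, β z ∈ Set.Icc (0 : ℝ) 1
  weight_sum : ∑ z, β z = 1
  weight_repr : ∑ z : R, β z • toReal (z : Fin d → ℤ) = ζ
  weight_rat : (∀ i, ∃ q : ℚ, ζ i = q) → ∀ z, ∃ q : ℚ, β z = q
  round_mem : ∀ n z, b n z = 0 ∨ b n z = 1
  round_zero : ∀ n z, β z = 0 → b n z = 0
  round_sum : ∀ n : ℕ, ∑ z, b n z = n - ∑ z, ⌊n * β z⌋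

/-- The lattice point `x̂_n(ζ) = ∑_z (⌊n β_z⌋ + b_z^{(n)}) z`. -/
def xhat {R : Finset (Fin d → ℤ)} (β : R → ℝ) (b : ℕ → R → ℤ) (n : ℕ) : Fin d → ℤ :=
  ∑ z : R, (⌊n * β z⌋ + b n z) • (z : Fin d → ℤ)

end RWRP

end

/-!
The logarithm of the point-to-point partition function is superadditive under concatenation of
paths, up to boundary terms that come from the dependence of the potential on `ℓ` future steps. Such
a term involves the potential only within `ℓ` steps of the junction, and subtracting it at the
starting point makes the process exactly superadditive (`superadditiveFamily_logWordPartition`). It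
is indexed by the vector `κ` of the numbers of uses of the steps in the face `U₀`; only lower bounds
on partition functions are needed, so paths that leave the face do no harm.

Along the multiples `m • κ` of a vector with positive entries, the upper and the lower rates do not
decrease when a path is prefixed by a step of the face, because the positive entries allow the
prefix to be compensated. By ergodicity both rates are constants. They agree by a greedy tiling
with blocks of nearly optimal rate (`tiling_lower_bound`): the sites that no block covers are
controlled by the maximal ergodic inequality, and neither a pointwise nor a subadditive ergodic
theorem is needed. This gives `SuperadditiveFamily.exists_tendsto_rate`.

The passage to all points of the relative interior is deterministic. Such a point `ζ` has a convex
representation with positive weights `α` (`IsFace.exists_pos_weights`), and every admissible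
approximating sequence of `ζ`, whatever its weights, has the same endpoints as paths with step
counts at bounded distance from `n α` (`exists_counts_near_of_same_barycentre`). Step counts near
`n α` can be extended to any step counts near `(1 + θ) n α` by a path of length of order `θ n`,
whose cost is a small multiple of `n` by the class `𝓛` condition
(`SuperadditiveFamily.exists_connection_cost`). That condition says nothing about zero steps; they
are spent at a site where the potential is below its average over a straight segment. Comparing
with the countably many directions `⌊N α⌋` from both sides yields the limit on one event for all
`ζ` (`SuperadditiveFamily.tendsto_directionRate`).
-/

noncomputable section

namespace RWRP

/-! ### The maximal ergodic inequality -/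

/-- The truncated maximal function `max(0, S₁ h, …, S_n h)` of the ergodic sums of `h` along `T`,
defined through the recursion that drives the proof of the maximal ergodic inequality. -/
def maxErgodicSum {Ω : Type*} (T : Ω → Ω) (h : Ω → ℝ) : ℕ → Ω → ℝ
  | 0 => fun _ => 0
  | n + 1 => fun ω => max 0 (h ω + maxErgodicSum T h n (T ω))

section Maximal

variable {Ω : Type*} {T : Ω → Ω} {h : Ω → ℝ}

lemma maxErgodicSum_nonneg (n : ℕ) (ω : Ω) : 0 ≤ maxErgodicSum T h n ω := by
  cases n with
  | zero => exact le_rfl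
  | succ n => exact le_max_left _ _

lemma maxErgodicSum_le_succ (n : ℕ) (ω : Ω) :
    maxErgodicSum T h n ω ≤ maxErgodicSum T h (n + 1) ω := by
  induction n generalizing ω with
  | zero => exact maxErgodicSum_nonneg _ _
  | succ n ih => exact max_le_max le_rfl (add_le_add le_rfl (ih (T ω)))

lemma birkhoffSum_le_maxErgodicSum (n : ℕ) (ω : Ω) :
    birkhoffSum T h n ω ≤ maxErgodicSum T h n ω := by
  induction n generalizing ω with
  | zero => simp [maxErgodicSum]
  | succ n ih =>
    rw [birkhoffSum_succ']
    exact (add_le_add le_rfl (ih (T ω))).trans (le_max_right _ _)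

variable [MeasurableSpace Ω] {P : Measure Ω}

lemma measurable_maxErgodicSum (hT : Measurable T) (hh : Measurable h) (n : ℕ) :
    Measurable (maxErgodicSum T h n) := by
  induction n with
  | zero => exact measurable_const
  | succ n ih => exact measurable_const.max (hh.add (ih.comp hT))

lemma integrable_maxErgodicSum [IsFiniteMeasure P] (hT : MeasurePreserving T P P)
    (hh : Integrable h P) (n : ℕ) : Integrable (maxErgodicSum T h n) P := by
  induction n with
  | zero => exact integrable_const 0
  | succ n ih =>
    exact (integrable_const (0 : ℝ)).sup (hh.add (hT.integrable_comp_of_integrable ih))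

/-- On the set where the maximal function is positive, `h` dominates the coboundary
`M - M ∘ T`, whose integral vanishes. -/
lemma setIntegral_nonneg_of_maxErgodicSum_pos [IsFiniteMeasure P] (hT : MeasurePreserving T P P)
    (hm : Measurable h) (hh : Integrable h P) (n : ℕ) :
    0 ≤ ∫ ω in {ω | 0 < maxErgodicSum T h (n + 1) ω}, h ω ∂P := by
  set M := maxErgodicSum T h (n + 1) with hM
  have hMm : Measurable M := measurable_maxErgodicSum hT.measurable hm _
  have hMi : Integrable M P := integrable_maxErgodicSum hT hh _
  have hMTi : Integrable (fun ω => M (T ω)) P := hT.integrable_comp_of_integrable hMi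
  set E : Set Ω := {ω | 0 < M ω} with hE
  have hEm : MeasurableSet E := measurableSet_lt measurable_const hMm
  have h1 : ∫ ω in E, M ω ∂P = ∫ ω, M ω ∂P := by
    refine setIntegral_eq_integral_of_forall_compl_eq_zero fun ω hω => ?_
    exact le_antisymm (not_lt.1 hω) (maxErgodicSum_nonneg _ _)
  have h2 : ∫ ω in E, M (T ω) ∂P ≤ ∫ ω, M (T ω) ∂P :=
    setIntegral_le_integral hMTi (Eventually.of_forall fun ω => maxErgodicSum_nonneg _ _)
  have h3 : ∫ ω, M (T ω) ∂P = ∫ ω, M ω ∂P := by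
    rw [← hT.map_eq, integral_map hT.measurable.aemeasurable hMm.aestronglyMeasurable, hT.map_eq]
  have h4 : ∫ ω in E, (M ω - M (T ω)) ∂P ≤ ∫ ω in E, h ω ∂P := by
    refine setIntegral_mono_on (hMi.sub hMTi).integrableOn hh.integrableOn hEm fun ω hω => ?_
    have h5 : M ω = h ω + maxErgodicSum T h n (T ω) := by
      have h6 : M ω = max 0 (h ω + maxErgodicSum T h n (T ω)) := rfl
      have h7 : 0 < M ω := hω
      rw [h6] at h7 ⊢
      exact max_eq_right (not_lt.1 fun h8 => by rw [max_eq_left h8.le] at h7; exact h7.false)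
    have h6 : maxErgodicSum T h n (T ω) ≤ M (T ω) := maxErgodicSum_le_succ _ _
    linarith
  rw [integral_sub hMi.integrableOn hMTi.integrableOn] at h4
  linarith

/-- The weak-type maximal inequality for ergodic averages of a nonnegative function. -/
theorem measure_exists_birkhoffSum_gt_le [IsProbabilityMeasure P] (hT : MeasurePreserving T P P)
    {f : Ω → ℝ} (hf : Measurable f) (hfi : Integrable f P) (hf0 : ∀ ω, 0 ≤ f ω) {c : ℝ}
    (hc : 0 < c) :
    P {ω | ∃ n : ℕ, c * n < birkhoffSum T f n ω} ≤ ENNReal.ofReal ((∫ ω, f ω ∂P) / c) := by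
  set h : Ω → ℝ := fun ω => f ω - c with hh
  have hhm : Measurable h := hf.sub measurable_const
  have hhi : Integrable h P := hfi.sub (integrable_const c)
  set E : ℕ → Set Ω := fun n => {ω | 0 < maxErgodicSum T h (n + 1) ω} with hE
  have hEm : ∀ n, MeasurableSet (E n) := fun n =>
    measurableSet_lt measurable_const (measurable_maxErgodicSum hT.measurable hhm _)
  have hbound : ∀ n, P (E n) ≤ ENNReal.ofReal ((∫ ω, f ω ∂P) / c) := by
    intro n
    have h1 : 0 ≤ ∫ ω in E n, h ω ∂P := setIntegral_nonneg_of_maxErgodicSum_pos hT hhm hhi n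
    rw [hh, integral_sub hfi.integrableOn (integrable_const c).integrableOn, setIntegral_const,
      smul_eq_mul] at h1
    have h2 : ∫ ω in E n, f ω ∂P ≤ ∫ ω, f ω ∂P :=
      setIntegral_le_integral hfi (Eventually.of_forall hf0)
    rw [← ofReal_measureReal (measure_ne_top P (E n))]
    refine ENNReal.ofReal_le_ofReal ?_
    rw [le_div_iff₀ hc]
    linarith
  have hsub : {ω | ∃ n : ℕ, c * n < birkhoffSum T f n ω} ⊆ ⋃ n, E n := by
    rintro ω ⟨n, hn⟩
    refine Set.mem_iUnion.2 ⟨n, ?_⟩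
    have h1 : birkhoffSum T h n ω = birkhoffSum T f n ω - c * n := by
      simp [birkhoffSum, hh, Finset.sum_sub_distrib, mul_comm]
    have h2 := birkhoffSum_le_maxErgodicSum (T := T) (h := h) n ω
    exact (by linarith : 0 < maxErgodicSum T h n ω).trans_le (maxErgodicSum_le_succ n ω)
  have hmono : Monotone E := monotone_nat_of_le_succ fun n ω hω =>
    lt_of_lt_of_le hω (maxErgodicSum_le_succ (n + 1) ω)
  refine (measure_mono hsub).trans ?_
  rw [hmono.measure_iUnion]
  exact iSup_le hbound

end Maximal

/-! ### A zero-one law for monotone events -/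

section ZeroOne

variable {G Ω ι : Type*} [AddCommGroup G] [Countable G] [MeasurableSpace Ω] [AddAction G Ω]
  [MeasurableConstVAdd G Ω] {P : Measure Ω} [IsProbabilityMeasure P] [VAddInvariantMeasure G Ω P]
  {u : ι → G}

/-- Under ergodicity, an event that contains its preimages under the generating shifts up to null
sets is trivial: by invariance of the measure it is almost invariant under the generated group, and
intersecting its translates over that countable group makes it strictly invariant. -/
lemma measure_eq_zero_or_one_of_shift_imp
    (hP : ∀ A : Set Ω, MeasurableSet A → (∀ i, (fun ω => u i +ᵥ ω) ⁻¹' A = A) → P A = 0 ∨ P A = 1)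
    {A : Set Ω} (hA : MeasurableSet A) (h : ∀ i, ∀ᵐ ω ∂P, u i +ᵥ ω ∈ A → ω ∈ A) :
    P A = 0 ∨ P A = 1 := by
  have hstab : AddSubgroup.closure (Set.range u) ≤ AddAction.aestabilizer G P A := by
    rw [AddSubgroup.closure_le]
    rintro _ ⟨i, rfl⟩
    have h1 : (fun ω => u i +ᵥ ω) ⁻¹' A =ᵐ[P] A :=
      ae_eq_of_ae_subset_of_measure_ge (h i) (measure_preimage_vadd P (u i) A).ge
        (measurable_const_vadd (u i) hA).nullMeasurableSet (measure_ne_top _ _)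
    have h2 : -u i ∈ AddAction.aestabilizer G P A := by
      rw [AddAction.mem_aestabilizer, ← Set.preimage_vadd]
      exact h1
    simpa using neg_mem h2
  set B : Set Ω := ⋂ x : AddSubgroup.closure (Set.range u), (fun ω => (x : G) +ᵥ ω) ⁻¹' A with hB
  have hBm : MeasurableSet B := MeasurableSet.iInter fun x => measurable_const_vadd (x : G) hA
  have hBA : B =ᵐ[P] A := by
    have h1 : ∀ x : AddSubgroup.closure (Set.range u), (fun ω => (x : G) +ᵥ ω) ⁻¹' A =ᵐ[P] A := by
      intro x
      have h2 := AddAction.mem_aestabilizer.1 (hstab (neg_mem x.2))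
      rwa [← Set.preimage_vadd] at h2
    have h2 := Filter.EventuallyEq.countable_iInter h1
    rwa [Set.iInter_const] at h2
  have hinv : ∀ i, (fun ω => u i +ᵥ ω) ⁻¹' B = B := by
    intro i
    have hi : u i ∈ AddSubgroup.closure (Set.range u) := AddSubgroup.subset_closure ⟨i, rfl⟩
    ext ω
    simp only [hB, Set.mem_preimage, Set.mem_iInter]
    constructor
    · intro hω x
      have := hω (x - ⟨u i, hi⟩)
      rwa [vadd_vadd, AddSubgroup.coe_sub, sub_add_cancel] at this
    · intro hω x
      have := hω (x + ⟨u i, hi⟩)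
      rwa [AddSubgroup.coe_add, add_vadd] at this
  rw [← measure_congr hBA]
  exact hP B hBm hinv

end ZeroOne

/-! ### Superadditive processes over one transformation -/

section Tiling

variable {Ω : Type*} {T : Ω → Ω} {a : ℕ → Ω → ℝ} {K : Ω → ℝ}

lemma neg_birkhoffSum_le_of_superadditive
    (ha : ∀ m n ω, a m ω + a n (T^[m] ω) ≤ a (m + n) ω) (hK : ∀ ω, -K ω ≤ a 1 ω) {M : ℕ}
    (hM : 1 ≤ M) (ω : Ω) : -birkhoffSum T K M ω ≤ a M ω := by
  induction M, hM using Nat.le_induction generalizing ω with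
  | base => simpa using hK ω
  | succ M hM ih =>
    rw [birkhoffSum_succ', add_comm M 1]
    have h1 := ha 1 M ω
    have h2 := ih (T ω)
    have h3 := hK ω
    rw [Function.iterate_one] at h1
    linarith

/-- A greedy tiling of `[0, M)`: a block of length at most `N` with rate at least `c` is used where
one starts, and a single step elsewhere. The function `φ` pays for single steps, and `ψ` for the
last `N` sites, where a block might not fit. -/
lemma tiling_lower_bound {φ ψ : Ω → ℝ} {c : ℝ} {N : ℕ}
    (ha : ∀ m n ω, a m ω + a n (T^[m] ω) ≤ a (m + n) ω) (hK : ∀ ω, -K ω ≤ a 1 ω)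
    (hφ0 : ∀ ω, 0 ≤ φ ω) (hψ0 : ∀ ω, 0 ≤ ψ ω) (hψ : ∀ ω, K ω + c ≤ ψ ω)
    (hφ : ∀ ω, (∃ n, 1 ≤ n ∧ n ≤ N ∧ c * n ≤ a n ω) ∨ K ω + c ≤ φ ω) (hN : 1 ≤ N) {M : ℕ} (hM : 1 ≤ M)
    (ω : Ω) :
    c * M - ∑ j ∈ Finset.range M, (φ (T^[j] ω) + if M ≤ j + N then ψ (T^[j] ω) else 0) ≤ a M ω := by
  have hterm : ∀ M j ω, 0 ≤ φ (T^[j] ω) + if M ≤ j + N then ψ (T^[j] ω) else 0 := by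
    intro M j ω
    refine add_nonneg (hφ0 _) ?_
    split_ifs
    exacts [hψ0 _, le_rfl]
  induction M using Nat.strong_induction_on generalizing ω with
  | _ M ih =>
  have hstep : ∀ n M', M = n + M' →
      ∑ j ∈ Finset.range M, (φ (T^[j] ω) + if M ≤ j + N then ψ (T^[j] ω) else 0) =
        ∑ j ∈ Finset.range n, (φ (T^[j] ω) + if M ≤ j + N then ψ (T^[j] ω) else 0) +
        ∑ j ∈ Finset.range M', (φ (T^[j] (T^[n] ω)) +
          if M' ≤ j + N then ψ (T^[j] (T^[n] ω)) else 0) := by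
    rintro n M' rfl
    rw [Finset.sum_range_add]
    congr 1
    refine Finset.sum_congr rfl fun j _ => ?_
    rw [← Function.iterate_add_apply, add_comm j n]
    have h1 : (n + M' ≤ n + j + N) = (M' ≤ j + N) := by
      rw [add_assoc, add_le_add_iff_left]
    simp only [h1]
  by_cases hMN : M ≤ N
  · have h1 := neg_birkhoffSum_le_of_superadditive ha hK hM ω
    have h2 : c * M + birkhoffSum T K M ω ≤
        ∑ j ∈ Finset.range M, (φ (T^[j] ω) + if M ≤ j + N then ψ (T^[j] ω) else 0) := by
      have h3 : c * M + birkhoffSum T K M ω = ∑ j ∈ Finset.range M, (K (T^[j] ω) + c) := by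
        simp [birkhoffSum, Finset.sum_add_distrib, mul_comm, add_comm]
      rw [h3]
      refine Finset.sum_le_sum fun j _ => ?_
      rw [if_pos (hMN.trans (Nat.le_add_left N j))]
      linarith [hφ0 (T^[j] ω), hψ (T^[j] ω)]
    linarith
  · push Not at hMN
    rcases hφ ω with ⟨n, hn1, hnN, hn⟩ | hbad
    · have hMn : n ≤ M := hnN.trans hMN.le
      obtain ⟨M', hM'⟩ : ∃ M', M = n + M' := ⟨M - n, by omega⟩
      have h1 := ih M' (by omega) (by omega) (T^[n] ω)
      have h2 := ha n M' ω
      have h3 : 0 ≤ ∑ j ∈ Finset.range n, (φ (T^[j] ω) + if M ≤ j + N then ψ (T^[j] ω) else 0) :=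
        Finset.sum_nonneg fun j _ => hterm M j ω
      rw [hstep n M' hM', hM']
      rw [hM'] at h3
      push_cast
      linarith
    · obtain ⟨M', hM'⟩ : ∃ M', M = 1 + M' := ⟨M - 1, by omega⟩
      have h1 := ih M' (by omega) (by omega) (T^[1] ω)
      have h2 := ha 1 M' ω
      have h3 : φ ω ≤
          ∑ j ∈ Finset.range 1, (φ (T^[j] ω) + if M ≤ j + N then ψ (T^[j] ω) else 0) := by
        rw [Finset.sum_range_one, Function.iterate_zero, id_eq]
        split_ifs
        · linarith [hψ0 ω]
        · simp
      have h4 := hK ω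
      rw [hstep 1 M' hM', hM']
      rw [hM'] at h3
      push_cast
      linarith

variable [MeasurableSpace Ω] {P : Measure Ω} [IsProbabilityMeasure P]

/-- A superadditive process with integrable lower bound is bounded below by a linear function with
positive probability. -/
lemma exists_measure_pos_forall_ge (hT : MeasurePreserving T P P)
    (ha : ∀ m n ω, a m ω + a n (T^[m] ω) ≤ a (m + n) ω) (hK : ∀ ω, -K ω ≤ a 1 ω)
    (hK0 : ∀ ω, 0 ≤ K ω) (hKm : Measurable K) (hKi : Integrable K P) :
    ∃ c : ℝ, 0 < P {ω | ∀ᶠ m : ℕ in atTop, c * m ≤ a m ω} := by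
  -- Any constant above the mean of `K` has an exceptional set of probability less than one.
  set c : ℝ := (∫ ω, K ω ∂P) + 1 with hc
  have hI : 0 ≤ ∫ ω, K ω ∂P := integral_nonneg hK0
  have hc0 : 0 < c := by linarith
  have h1 := measure_exists_birkhoffSum_gt_le hT hKm hKi hK0 hc0
  have h2 : P {ω | ∃ n : ℕ, c * n < birkhoffSum T K n ω} < 1 := by
    refine h1.trans_lt ?_
    rw [ENNReal.ofReal_lt_one, div_lt_one hc0]
    linarith
  refine ⟨-c, pos_iff_ne_zero.2 fun h3 => ?_⟩
  have h4 : (Set.univ : Set Ω) ⊆ {ω | ∃ n : ℕ, c * n < birkhoffSum T K n ω} ∪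
      {ω | ∀ᶠ m : ℕ in atTop, -c * m ≤ a m ω} := by
    intro ω _
    by_cases h5 : ∃ n : ℕ, c * n < birkhoffSum T K n ω
    · exact Or.inl h5
    · push Not at h5
      refine Or.inr ?_
      filter_upwards [eventually_ge_atTop 1] with m hm
      have := neg_birkhoffSum_le_of_superadditive ha hK hm ω
      have := h5 m
      linarith
  have h5 := (measure_mono h4).trans (measure_union_le (μ := P) _ _)
  rw [measure_univ, h3, add_zero] at h5
  exact (h5.trans_lt h2).false

/-- If almost every orbit starts a block of rate at least `c`, then the process has lower rate at
least `c - η` with positive probability: along the greedy tiling the sites where no short block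
starts are rare by the maximal ergodic inequality. -/
lemma measure_pos_eventually_ge (hT : MeasurePreserving T P P)
    (ha : ∀ m n ω, a m ω + a n (T^[m] ω) ≤ a (m + n) ω) (hK : ∀ ω, -K ω ≤ a 1 ω)
    (hK0 : ∀ ω, 0 ≤ K ω) (hKm : Measurable K) (hKi : Integrable K P) (ham : ∀ n, Measurable (a n))
    (hKs : ∀ᵐ ω ∂P, ∀ η > 0, ∀ᶠ M : ℕ in atTop, ∀ j ≤ M, K (T^[j] ω) ≤ η * M)
    {c : ℝ} (hc : ∀ᵐ ω ∂P, ∃ n : ℕ, 1 ≤ n ∧ c * n ≤ a n ω) {η : ℝ} (hη : 0 < η) :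
    0 < P {ω | ∀ᶠ m : ℕ in atTop, (c - η) * m ≤ a m ω} := by
  set good : ℕ → Set Ω := fun N => {ω | ∃ n, 1 ≤ n ∧ n ≤ N ∧ c * n ≤ a n ω} with hgood
  have hgm : ∀ N, MeasurableSet (good N) := by
    intro N
    have : good N = ⋃ n ∈ Finset.Icc 1 N, {ω | c * n ≤ a n ω} := by
      ext ω
      simp [hgood, and_assoc]
    rw [this]
    exact Finset.measurableSet_biUnion _ fun n _ => measurableSet_le measurable_const (ham n)
  set ψ : Ω → ℝ := fun ω => K ω + |c| with hψdef
  have hψ0 : ∀ ω, 0 ≤ ψ ω := fun ω => add_nonneg (hK0 ω) (abs_nonneg c)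
  have hψm : Measurable ψ := hKm.add measurable_const
  have hψi : Integrable ψ P := hKi.add (integrable_const _)
  set φ : ℕ → Ω → ℝ := fun N => (good N)ᶜ.indicator ψ with hφdef
  have hlim : Tendsto (fun N => ∫ ω, φ N ω ∂P) atTop (𝓝 (∫ _, (0 : ℝ) ∂P)) := by
    refine tendsto_integral_of_dominated_convergence ψ
      (fun N => (hψm.indicator (hgm N).compl).aestronglyMeasurable) hψi
      (fun N => Eventually.of_forall fun ω => ?_) ?_
    · rw [Real.norm_eq_abs, abs_of_nonneg (Set.indicator_nonneg (fun x _ => hψ0 x) ω)]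
      exact Set.indicator_le_self' (fun x _ => hψ0 x) ω
    · filter_upwards [hc] with ω ⟨n, hn1, hn⟩
      refine tendsto_const_nhds.congr' ?_
      filter_upwards [eventually_ge_atTop n] with N hN
      have hω : ω ∈ good N := ⟨n, hn1, hN, hn⟩
      exact (Set.indicator_of_notMem (Set.notMem_compl_iff.2 hω) _).symm
  rw [integral_zero] at hlim
  obtain ⟨N, hN, hN1⟩ :=
    ((hlim.eventually (gt_mem_nhds (half_pos hη))).and (eventually_ge_atTop 1)).exists
  have h1 := measure_exists_birkhoffSum_gt_le hT (hψm.indicator (hgm N).compl)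
    (hψi.indicator (hgm N).compl) (fun ω => Set.indicator_nonneg (fun x _ => hψ0 x) ω) (half_pos hη)
  have h2 : P {ω | ∃ n : ℕ, η / 2 * n < birkhoffSum T (φ N) n ω} < 1 := by
    refine h1.trans_lt ?_
    rw [ENNReal.ofReal_lt_one, div_lt_one (half_pos hη)]
    exact hN
  refine pos_iff_ne_zero.2 fun h3 => ?_
  have h4 : ∀ᵐ ω ∂P, ω ∈ {ω | ∃ n : ℕ, η / 2 * n < birkhoffSum T (φ N) n ω} := by
    have h3' : ∀ᵐ ω ∂P, ω ∉ {ω | ∀ᶠ m : ℕ in atTop, (c - η) * m ≤ a m ω} :=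
      measure_eq_zero_iff_ae_notMem.1 h3
    filter_upwards [h3', hKs] with ω hω hKω
    by_contra h5
    simp only [not_exists, not_lt] at h5
    refine hω ?_
    have hN0 : (0 : ℝ) < 4 * (N + 1) := by positivity
    have hc' : ∀ᶠ M : ℕ in atTop, N * |c| ≤ η / 4 * M :=
      (tendsto_natCast_atTop_atTop.const_mul_atTop (by positivity)).eventually_ge_atTop _
    filter_upwards [hKω (η / (4 * (N + 1))) (by positivity), hc', eventually_ge_atTop 1]
      with M hM1 hM2 hM3
    have h6 := tiling_lower_bound (φ := φ N) (ψ := ψ) (c := c) (N := N) ha hK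
      (fun ω => Set.indicator_nonneg (fun x _ => hψ0 x) ω) hψ0
      (fun ω => by rw [hψdef]; linarith [le_abs_self c])
      (fun ω => by
        by_cases h : ω ∈ good N
        · exact Or.inl h
        · right
          rw [hφdef]
          simp only
          rw [Set.indicator_of_mem h]
          rw [hψdef]; linarith [le_abs_self c]) hN1 hM3 ω
    rw [Finset.sum_add_distrib] at h6
    have h7 : ∑ j ∈ Finset.range M, φ N (T^[j] ω) ≤ η / 2 * M := h5 M
    have h8 : ∑ j ∈ Finset.range M, (if M ≤ j + N then ψ (T^[j] ω) else 0) ≤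
        N * (η / (4 * (N + 1)) * M + |c|) := by
      rw [← Finset.sum_filter]
      have hcard : ((Finset.range M).filter fun j => M ≤ j + N).card ≤ N := by
        calc _ ≤ (Finset.Ico (M - N) M).card := by
              refine Finset.card_le_card fun j hj => ?_
              simp only [Finset.mem_filter, Finset.mem_range] at hj
              simp only [Finset.mem_Ico]
              omega
          _ ≤ N := by rw [Nat.card_Ico]; omega
      have hb : ∀ j ∈ (Finset.range M).filter fun j => M ≤ j + N,
          ψ (T^[j] ω) ≤ η / (4 * (N + 1)) * M + |c| := by
        intro j hj
        simp only [Finset.mem_filter, Finset.mem_range] at hj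
        have := hM1 j hj.1.le
        rw [hψdef]
        linarith
      refine (Finset.sum_le_card_nsmul _ _ _ hb).trans ?_
      rw [nsmul_eq_mul]
      exact mul_le_mul_of_nonneg_right (by exact_mod_cast hcard) (by positivity)
    have h9 : N * (η / (4 * (N + 1)) * M) ≤ η / 4 * M := by
      have : N * (η / (4 * (N + 1)) * M) = η / 4 * M * (N / (N + 1)) := by
        field_simp
      rw [this]
      refine mul_le_of_le_one_right (by positivity) ?_
      rw [div_le_one (by positivity)]
      linarith
    have : N * (η / (4 * (N + 1)) * M + |c|) = N * (η / (4 * (N + 1)) * M) + N * |c| := by ring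
    linarith
  have h5 := measure_congr (eventuallyEq_univ.2 h4)
  rw [measure_univ] at h5
  exact h2.ne h5

end Tiling

/-! ### Superadditive families indexed by step counts -/

section Family

variable {G Ω ι : Type*} [AddCommGroup G] [AddAction G Ω] [Fintype ι]

/-- The displacement of a path that uses the step `u i` exactly `κ i` times. -/
def displacement (u : ι → G) (κ : ι → ℕ) : G := ∑ i, κ i • u i

lemma displacement_add (u : ι → G) (κ κ' : ι → ℕ) :
    displacement u (κ + κ') = displacement u κ + displacement u κ' := by
  simp [displacement, add_smul, Finset.sum_add_distrib]

lemma displacement_nsmul (u : ι → G) (m : ℕ) (κ : ι → ℕ) :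
    displacement u (m • κ) = m • displacement u κ := by
  simp [displacement, Finset.smul_sum, mul_smul]

lemma exists_eq_single_add {ι : Type*} [DecidableEq ι] {κ : ι → ℕ} {i : ι} (hi : κ i ≠ 0) :
    ∃ κ' : ι → ℕ, κ = Pi.single i 1 + κ' := by
  have h : (Pi.single i 1 : ι → ℕ) ≤ κ := by
    intro j
    by_cases h : j = i
    · subst h
      simpa using Nat.one_le_iff_ne_zero.2 hi
    · simp [h]
  exact ⟨κ - Pi.single i 1, (add_tsub_cancel_of_le h).symm⟩

variable [DecidableEq ι]

lemma displacement_single (u : ι → G) (i : ι) (k : ℕ) :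
    displacement u (Pi.single i k) = k • u i := by
  rw [displacement, Finset.sum_eq_single i]
  · simp
  · intro j _ hj
    simp [hj]
  · simp

/-- A family of random variables indexed by step counts that is superadditive along the action and
whose one-step values are bounded below by `-H`. -/
structure SuperadditiveFamily (u : ι → G) (H : Ω → ℝ) (F : (ι → ℕ) → Ω → ℝ) : Prop where
  bound_nonneg : ∀ ω, 0 ≤ H ω
  add_le : ∀ κ κ' ω, F κ ω + F κ' (displacement u κ +ᵥ ω) ≤ F (κ + κ') ω
  zero_ge : ∀ ω, -H ω ≤ F 0 ω
  single_ge : ∀ i ω, -H ω ≤ F (Pi.single i 1) ω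

/-- The sum of the values of `H` at the sites of a list. -/
def siteSum (H : Ω → ℝ) (l : List G) (ω : Ω) : ℝ := (l.map fun y => H (y +ᵥ ω)).sum

lemma siteSum_cons (H : Ω → ℝ) (y : G) (l : List G) (ω : Ω) :
    siteSum H (y :: l) ω = H (y +ᵥ ω) + siteSum H l ω := by
  simp [siteSum]

lemma siteSum_nonneg {H : Ω → ℝ} (hH : ∀ ω, 0 ≤ H ω) (l : List G) (ω : Ω) :
    0 ≤ siteSum H l ω := by
  refine List.sum_nonneg fun x hx => ?_
  obtain ⟨y, _, rfl⟩ := List.mem_map.1 hx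
  exact hH _

/-- Every member of the family is bounded below by minus a sum of `H` over the sites of a path with
the prescribed step counts. -/
lemma SuperadditiveFamily.exists_siteSum_le {u : ι → G} {H : Ω → ℝ} {F : (ι → ℕ) → Ω → ℝ}
    (hF : SuperadditiveFamily u H F) (κ : ι → ℕ) :
    ∃ l : List G, ∀ ω, -siteSum H l ω ≤ F κ ω := by
  induction hn : ∑ i, κ i generalizing κ with
  | zero =>
    have h1 : κ = 0 := by
      funext i
      exact (Finset.sum_eq_zero_iff.1 hn) i (Finset.mem_univ i)
    refine ⟨[0], fun ω => ?_⟩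
    subst h1
    simpa [siteSum] using hF.zero_ge ω
  | succ n ih =>
    obtain ⟨i, -, hi⟩ : ∃ i ∈ Finset.univ, κ i ≠ 0 := Finset.exists_ne_zero_of_sum_ne_zero (by omega)
    obtain ⟨κ', rfl⟩ := exists_eq_single_add hi
    have h2 : ∑ j, κ' j = n := by
      simp only [Pi.add_apply, Finset.sum_add_distrib, Fintype.sum_pi_single'] at hn
      omega
    obtain ⟨l, hl⟩ := ih κ' h2
    refine ⟨0 :: l.map (· + u i), fun ω => ?_⟩
    have h3 := hF.add_le (Pi.single i 1) κ' ω
    have h4 := hF.single_ge i ω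
    have h5 := hl (displacement u (Pi.single i 1) +ᵥ ω)
    rw [displacement_single, one_smul] at h3 h5
    have h6 : siteSum H (l.map (· + u i)) ω = siteSum H l (u i +ᵥ ω) := by
      simp [siteSum, Function.comp_def, add_vadd]
    rw [siteSum_cons, zero_vadd, h6]
    linarith

/-- The values of `H` along the orbit of `ω` grow sublinearly with the distance to the origin. -/
def SublinearAt (p : AddGroupSeminorm G) (H : Ω → ℝ) (ω : Ω) : Prop :=
  ∀ η > 0, ∀ᶠ n : ℕ in atTop, ∀ x : G, p x ≤ n → H (x +ᵥ ω) ≤ η * n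

lemma SublinearAt.eventually_le {p : AddGroupSeminorm G} {H : Ω → ℝ} {ω : Ω}
    (h : SublinearAt p H ω) (C : ℝ) {η : ℝ} (hη : 0 < η) :
    ∀ᶠ n : ℕ in atTop, ∀ x : G, p x ≤ C * n → H (x +ᵥ ω) ≤ η * n := by
  obtain ⟨D, hD⟩ := exists_nat_ge (max C 1)
  have hD1 : (1 : ℝ) ≤ D := (le_max_right _ _).trans hD
  have hD0 : (0 : ℝ) < D := by linarith
  have h1 := (tendsto_id.const_mul_atTop' (show 0 < D by exact_mod_cast hD0)).eventually
    (h (η / D) (by positivity))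
  filter_upwards [h1] with n hn x hx
  refine (hn x (hx.trans ?_)).trans_eq ?_
  · push_cast
    exact mul_le_mul_of_nonneg_right ((le_max_left _ _).trans hD) (Nat.cast_nonneg n)
  · push_cast
    simp only [id]
    field_simp

lemma SublinearAt.siteSum_eventually_le {p : AddGroupSeminorm G} {H : Ω → ℝ} {ω : Ω}
    (h : SublinearAt p H ω) (l : List G) (C : ℝ) {η : ℝ} (hη : 0 < η) :
    ∀ᶠ n : ℕ in atTop, ∀ x : G, p x ≤ C * n → siteSum H l (x +ᵥ ω) ≤ η * n := by
  induction l generalizing η with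
  | nil =>
    refine Eventually.of_forall fun n x _ => ?_
    simp only [siteSum, List.map_nil, List.sum_nil]
    positivity
  | cons y l ih =>
    filter_upwards [ih (half_pos hη), h.eventually_le (C + 1) (half_pos hη),
      tendsto_natCast_atTop_atTop.eventually_ge_atTop (p y)] with n h1 h2 h3 x hx
    have h4 := h1 x hx
    have h5 := h2 (y + x) ((map_add_le_add p y x).trans (by linarith))
    rw [add_vadd] at h5
    rw [siteSum_cons]
    linarith

lemma iterate_const_vadd (v : G) (m : ℕ) (ω : Ω) : (fun ω => v +ᵥ ω)^[m] ω = (m • v) +ᵥ ω := by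
  induction m with
  | zero => simp
  | succ m ih => rw [Function.iterate_succ_apply', ih, succ_nsmul', add_vadd]

lemma map_nsmul_le_mul (p : AddGroupSeminorm G) (m : ℕ) (v : G) : p (m • v) ≤ m * p v := by
  induction m with
  | zero => simp
  | succ m ih =>
    rw [succ_nsmul]
    push_cast
    linarith [map_add_le_add p (m • v) v]

/-- Prefixing one step `u i` to a path of positive counts `m • κ` and completing it to
`(m + 1) • κ` costs `o(m)`. -/
lemma SuperadditiveFamily.eventually_shift_le {u : ι → G} {H : Ω → ℝ} {F : (ι → ℕ) → Ω → ℝ}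
    (hF : SuperadditiveFamily u H F) {κ : ι → ℕ} (hκ : ∀ i, 1 ≤ κ i) (i : ι)
    {p : AddGroupSeminorm G} {ω : Ω} (hω : SublinearAt p H ω) {η : ℝ} (hη : 0 < η) :
    ∀ᶠ m : ℕ in atTop, F (m • κ) (u i +ᵥ ω) - η * m ≤ F ((m + 1) • κ) ω := by
  obtain ⟨κ', hκ'⟩ := exists_eq_single_add (Nat.one_le_iff_ne_zero.1 (hκ i))
  obtain ⟨l, hl⟩ := hF.exists_siteSum_le κ'
  set v := displacement u κ with hv
  filter_upwards [hω.siteSum_eventually_le l (p v + 1) (half_pos hη),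
    tendsto_natCast_atTop_atTop.eventually_ge_atTop (p (u i)),
    (tendsto_natCast_atTop_atTop.const_mul_atTop (half_pos hη)).eventually_ge_atTop (H ω)]
    with m h1 h2 h3
  have h4 : (m + 1) • κ = Pi.single i 1 + (m • κ + κ') := by
    calc (m + 1) • κ = m • κ + κ := succ_nsmul κ m
      _ = m • κ + (Pi.single i 1 + κ') := by rw [← hκ']
      _ = Pi.single i 1 + (m • κ + κ') := add_left_comm _ _ _
  have h5 := hF.add_le (Pi.single i 1) (m • κ + κ') ω
  have h6 := hF.add_le (m • κ) κ' (u i +ᵥ ω)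
  rw [displacement_single, one_smul, ← h4] at h5
  rw [displacement_nsmul, vadd_vadd] at h6
  have h7 := hl ((m • v + u i) +ᵥ ω)
  have h8 := h1 (m • v + u i) (by
    have := map_add_le_add p (m • v) (u i)
    have := map_nsmul_le_mul p m v
    linarith)
  have h9 := hF.single_ge i ω
  linarith

end Family

/-! ### Almost sure limits along multiples of positive step counts -/

lemma measurableSet_eventually_le {Ω : Type*} [MeasurableSpace Ω] {f g : ℕ → Ω → ℝ}
    (hf : ∀ n, Measurable (f n)) (hg : ∀ n, Measurable (g n)) :
    MeasurableSet {ω | ∀ᶠ n in atTop, f n ω ≤ g n ω} := by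
  have : {ω | ∀ᶠ n in atTop, f n ω ≤ g n ω} = ⋃ N, ⋂ n ∈ Set.Ici N, {ω | f n ω ≤ g n ω} := by
    ext ω
    simp [eventually_atTop]
  rw [this]
  exact MeasurableSet.iUnion fun N => MeasurableSet.biInter (Set.to_countable _)
    fun n _ => measurableSet_le (hf n) (hg n)

lemma measurableSet_frequently_le {Ω : Type*} [MeasurableSpace Ω] {f g : ℕ → Ω → ℝ}
    (hf : ∀ n, Measurable (f n)) (hg : ∀ n, Measurable (g n)) :
    MeasurableSet {ω | ∃ᶠ n in atTop, f n ω ≤ g n ω} := by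
  have : {ω | ∃ᶠ n in atTop, f n ω ≤ g n ω} = ⋂ N, ⋃ n ∈ Set.Ici N, {ω | f n ω ≤ g n ω} := by
    ext ω
    simp [frequently_atTop]
  rw [this]
  exact MeasurableSet.iInter fun N => MeasurableSet.biUnion (Set.to_countable _)
    fun n _ => measurableSet_le (hf n) (hg n)

/-- The event that the upper rate `limsup aₘ / m` is at least `c`. -/
def upperRateSet {Ω : Type*} (a : ℕ → Ω → ℝ) (c : ℝ) : Set Ω :=
  {ω | ∀ q : ℚ, (q : ℝ) < c → ∃ᶠ m : ℕ in atTop, q * m ≤ a m ω}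

/-- The event that the lower rate `liminf aₘ / m` is at least `c`. -/
def lowerRateSet {Ω : Type*} (a : ℕ → Ω → ℝ) (c : ℝ) : Set Ω :=
  {ω | ∀ q : ℚ, (q : ℝ) < c → ∀ᶠ m : ℕ in atTop, q * m ≤ a m ω}

lemma measurableSet_upperRateSet {Ω : Type*} [MeasurableSpace Ω] {a : ℕ → Ω → ℝ}
    (ha : ∀ n, Measurable (a n)) (c : ℝ) : MeasurableSet (upperRateSet a c) := by
  have : upperRateSet a c =
      ⋂ q : {q : ℚ // (q : ℝ) < c}, {ω | ∃ᶠ m : ℕ in atTop, ((q : ℚ) : ℝ) * m ≤ a m ω} := by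
    ext ω
    simp [upperRateSet]
  rw [this]
  exact MeasurableSet.iInter fun q => measurableSet_frequently_le (fun _ => measurable_const) ha

lemma measurableSet_lowerRateSet {Ω : Type*} [MeasurableSpace Ω] {a : ℕ → Ω → ℝ}
    (ha : ∀ n, Measurable (a n)) (c : ℝ) : MeasurableSet (lowerRateSet a c) := by
  have : lowerRateSet a c =
      ⋂ q : {q : ℚ // (q : ℝ) < c}, {ω | ∀ᶠ m : ℕ in atTop, ((q : ℚ) : ℝ) * m ≤ a m ω} := by
    ext ω
    simp [lowerRateSet]
  rw [this]
  exact MeasurableSet.iInter fun q => measurableSet_eventually_le (fun _ => measurable_const) ha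

lemma eventually_imp_succ_of_shift_le {a b : ℕ → ℝ}
    (h : ∀ η > 0, ∀ᶠ m : ℕ in atTop, b m - η * m ≤ a (m + 1)) {q r : ℝ} (hqr : q < r) :
    ∀ᶠ m : ℕ in atTop, r * m ≤ b m → q * (m + 1 : ℕ) ≤ a (m + 1) := by
  have hpos : 0 < (r - q) / 2 := by linarith
  filter_upwards [h _ hpos,
    (tendsto_natCast_atTop_atTop.const_mul_atTop hpos).eventually_ge_atTop q] with m h1 h2 h3
  push_cast
  linarith

section Limit

variable {G Ω ι : Type*} [AddCommGroup G] [MeasurableSpace Ω] [AddAction G Ω]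
  [MeasurableConstVAdd G Ω] {P : Measure Ω} {H : Ω → ℝ}

lemma measurable_siteSum (hH : Measurable H) (l : List G) : Measurable (siteSum H l) := by
  induction l with
  | nil =>
    have : siteSum H ([] : List G) = fun _ => 0 := by
      funext ω
      simp [siteSum]
    rw [this]
    exact measurable_const
  | cons y l ih =>
    have : siteSum H (y :: l) = fun ω => H (y +ᵥ ω) + siteSum H l ω := by
      funext ω
      exact siteSum_cons H y l ω
    rw [this]
    exact (hH.comp (measurable_const_vadd y)).add ih

variable [VAddInvariantMeasure G Ω P]

lemma integrable_comp_vadd (hH : Integrable H P) (y : G) : Integrable (fun ω => H (y +ᵥ ω)) P :=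
  (measurePreserving_vadd y P).integrable_comp_of_integrable hH

lemma integrable_siteSum [IsProbabilityMeasure P] (hH : Integrable H P) (l : List G) : Integrable (siteSum H l) P := by
  induction l with
  | nil =>
    have : siteSum H ([] : List G) = fun _ => 0 := by
      funext ω
      simp [siteSum]
    rw [this]
    exact integrable_const 0
  | cons y l ih =>
    have : siteSum H (y :: l) = fun ω => H (y +ᵥ ω) + siteSum H l ω := by
      funext ω
      exact siteSum_cons H y l ω
    rw [this]
    exact (integrable_comp_vadd hH y).add ih

variable [Countable G] [IsProbabilityMeasure P] [Fintype ι] [DecidableEq ι] {u : ι → G}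
  {F : (ι → ℕ) → Ω → ℝ}

/-- Along multiples of a positive vector of step counts, a superadditive family over an ergodic
environment has an almost sure nonrandom rate. The upper and the lower rate do not decrease when
a step is put in front of a path, so they are constants, and the tiling argument identifies them. -/
theorem SuperadditiveFamily.exists_tendsto_rate (hF : SuperadditiveFamily u H F)
    (hP : ∀ A : Set Ω, MeasurableSet A → (∀ i, (fun ω => u i +ᵥ ω) ⁻¹' A = A) → P A = 0 ∨ P A = 1)
    (hHm : Measurable H) (hHi : Integrable H P) (hFm : ∀ κ, Measurable (F κ))
    {p : AddGroupSeminorm G} (hs : ∀ᵐ ω ∂P, SublinearAt p H ω) {κ : ι → ℕ} (hκ : ∀ i, 1 ≤ κ i) :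
    ∃ Λ : EReal, ⊥ < Λ ∧
      ∀ᵐ ω ∂P, Tendsto (fun m : ℕ => ((F (m • κ) ω / m : ℝ) : EReal)) atTop (𝓝 Λ) := by
  set v := displacement u κ with hv
  set T : Ω → Ω := fun ω => v +ᵥ ω with hTdef
  have hT : MeasurePreserving T P P := measurePreserving_vadd v P
  set a : ℕ → Ω → ℝ := fun m => F (m • κ) with ha
  have ham : ∀ n, Measurable (a n) := fun n => hFm _
  have hadd : ∀ m n ω, a m ω + a n (T^[m] ω) ≤ a (m + n) ω := by
    intro m n ω
    have := hF.add_le (m • κ) (n • κ) ω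
    rwa [displacement_nsmul, ← add_smul, ← iterate_const_vadd] at this
  obtain ⟨l, hl⟩ := hF.exists_siteSum_le κ
  set K := siteSum H l with hKdef
  have hK : ∀ ω, -K ω ≤ a 1 ω := fun ω => by simpa [ha] using hl ω
  have hK0 : ∀ ω, 0 ≤ K ω := siteSum_nonneg hF.bound_nonneg l
  have hKm : Measurable K := measurable_siteSum hHm l
  have hKi : Integrable K P := integrable_siteSum hHi l
  have hKs : ∀ᵐ ω ∂P, ∀ η > 0, ∀ᶠ M : ℕ in atTop, ∀ j ≤ M, K (T^[j] ω) ≤ η * M := by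
    filter_upwards [hs] with ω hω η hη
    filter_upwards [hω.siteSum_eventually_le l (p v) hη] with M hM j hj
    rw [hTdef, iterate_const_vadd]
    refine hM _ ((map_nsmul_le_mul p j v).trans ?_)
    rw [mul_comm]
    exact mul_le_mul_of_nonneg_left (by exact_mod_cast hj) (apply_nonneg p v)
  have hshift : ∀ᵐ ω ∂P, ∀ i, ∀ q r : ℝ, q < r →
      ∀ᶠ m : ℕ in atTop, r * m ≤ a m (u i +ᵥ ω) → q * (m + 1 : ℕ) ≤ a (m + 1) ω := by
    filter_upwards [hs] with ω hω i q r hqr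
    exact eventually_imp_succ_of_shift_le (a := fun m => a m ω) (b := fun m => a m (u i +ᵥ ω))
      (fun η hη => hF.eventually_shift_le hκ i hω hη) hqr
  have hup : ∀ c, P (upperRateSet a c) = 0 ∨ P (upperRateSet a c) = 1 := by
    intro c
    refine measure_eq_zero_or_one_of_shift_imp hP (measurableSet_upperRateSet ham c) fun i => ?_
    filter_upwards [hshift] with ω hω hmem q hq
    obtain ⟨r, hqr, hrc⟩ := exists_rat_btwn hq
    have h1 := ((hmem r hrc).and_eventually (hω i q r hqr)).mono fun m hm => hm.2 hm.1
    exact (tendsto_add_atTop_nat 1).frequently h1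
  have hlow : ∀ c, P (lowerRateSet a c) = 0 ∨ P (lowerRateSet a c) = 1 := by
    intro c
    refine measure_eq_zero_or_one_of_shift_imp hP (measurableSet_lowerRateSet ham c) fun i => ?_
    filter_upwards [hshift] with ω hω hmem q hq
    obtain ⟨r, hqr, hrc⟩ := exists_rat_btwn hq
    have h1 : ∀ᶠ m : ℕ in atTop, (q : ℝ) * (m + 1 : ℕ) ≤ a (m + 1) ω :=
      ((hmem r hrc).and (hω i q r hqr)).mono fun m hm => hm.2 hm.1
    rw [← map_add_atTop_eq_nat 1]
    exact eventually_map.2 h1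
  have hlowpos : ∀ c, 0 < P {ω | ∀ᶠ m : ℕ in atTop, c * m ≤ a m ω} → P (lowerRateSet a c) = 1 := by
    intro c hc
    have hsub : {ω | ∀ᶠ m : ℕ in atTop, c * m ≤ a m ω} ⊆ lowerRateSet a c := by
      intro ω hω q hq
      filter_upwards [hω] with m hm
      exact (mul_le_mul_of_nonneg_right hq.le (Nat.cast_nonneg m)).trans hm
    exact (hlow c).resolve_left (hc.trans_le (measure_mono hsub)).ne'
  have hup_low : ∀ c c', P (upperRateSet a c) = 1 → c' < c → P (lowerRateSet a c') = 1 := by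
    intro c c' hc hcc
    obtain ⟨q, hq1, hq2⟩ := exists_rat_btwn hcc
    refine hlowpos c' ?_
    have h1 : ∀ᵐ ω ∂P, ∃ n : ℕ, 1 ≤ n ∧ (q : ℝ) * n ≤ a n ω := by
      filter_upwards [(mem_ae_iff_prob_eq_one (measurableSet_upperRateSet ham c)).2 hc] with ω hω
      exact ((hω q hq2).and_eventually (eventually_ge_atTop 1)).exists.imp fun n hn => ⟨hn.2, hn.1⟩
    have h2 := measure_pos_eventually_ge hT hadd hK hK0 hKm hKi ham hKs h1 (sub_pos.2 hq1)
    simpa using h2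
  have hlow_up : ∀ c, P (lowerRateSet a c) = 1 → P (upperRateSet a c) = 1 := by
    intro c hc
    refine le_antisymm prob_le_one (hc.ge.trans (measure_mono fun ω hω q hq => ?_))
    exact (hω q hq).frequently
  obtain ⟨c₀, hc₀⟩ := exists_measure_pos_forall_ge hT hadd hK hK0 hKm hKi
  set S : Set EReal := {x | ∃ c : ℝ, x = c ∧ P (upperRateSet a c) = 1} with hS
  refine ⟨sSup S, (EReal.bot_lt_coe c₀).trans_le
    (le_sSup ⟨c₀, rfl, hlow_up _ (hlowpos _ hc₀)⟩), ?_⟩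
  have hA : ∀ᵐ ω ∂P, ∀ q : ℚ, ((q : ℝ) : EReal) < sSup S → ∀ᶠ m : ℕ in atTop, q * m ≤ a m ω := by
    rw [ae_all_iff]
    intro q
    by_cases hq : ((q : ℝ) : EReal) < sSup S
    · obtain ⟨_, ⟨c, rfl, hc⟩, hqc⟩ := lt_sSup_iff.1 hq
      obtain ⟨c', hc1, hc2⟩ := exists_between (EReal.coe_lt_coe_iff.1 hqc)
      filter_upwards [(mem_ae_iff_prob_eq_one (measurableSet_lowerRateSet ham c')).2
        (hup_low c c' hc hc2)] with ω hω _
      exact hω q hc1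
    · exact Eventually.of_forall fun ω h => absurd h hq
  have hB : ∀ᵐ ω ∂P, ∀ q : ℚ, sSup S < ((q : ℝ) : EReal) → ∀ᶠ m : ℕ in atTop, a m ω ≤ q * m := by
    rw [ae_all_iff]
    intro q
    by_cases hq : sSup S < ((q : ℝ) : EReal)
    · have h1 : P (upperRateSet a q) = 0 :=
        (hup q).resolve_right fun h => hq.not_ge (le_sSup ⟨q, rfl, h⟩)
      filter_upwards [measure_eq_zero_iff_ae_notMem.1 h1] with ω hω _
      have hω' : ¬ ∀ r : ℚ, (r : ℝ) < q → ∃ᶠ m : ℕ in atTop, r * m ≤ a m ω := hω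
      push Not at hω'
      obtain ⟨r, hr, h2⟩ := hω'
      filter_upwards [h2] with m hm
      exact hm.le.trans (mul_le_mul_of_nonneg_right hr.le (Nat.cast_nonneg m))
    · exact Eventually.of_forall fun ω h => absurd h hq
  filter_upwards [hA, hB] with ω h1 h2
  refine tendsto_order.2 ⟨fun x hx => ?_, fun x hx => ?_⟩
  · obtain ⟨q, hq1, hq2⟩ := EReal.lt_iff_exists_rat_btwn.1 hx
    filter_upwards [h1 q hq2, eventually_ge_atTop 1] with m hm hm1
    refine hq1.trans_le (EReal.coe_le_coe_iff.2 ?_)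
    rwa [le_div_iff₀ (by exact_mod_cast hm1)]
  · obtain ⟨q, hq1, hq2⟩ := EReal.lt_iff_exists_rat_btwn.1 hx
    filter_upwards [h2 q hq1, eventually_ge_atTop 1] with m hm hm1
    refine lt_of_le_of_lt (EReal.coe_le_coe_iff.2 ?_) hq2
    rwa [div_le_iff₀ (by exact_mod_cast hm1)]

end Limit

/-! ### The cost of short connecting paths -/

section Connect

variable {G Ω ι : Type*} [AddCommGroup G] [AddAction G Ω] {p : AddGroupSeminorm G} {u : ι → G}
  {H : Ω → ℝ} {ω : Ω}

/-- Sums of `H` along straight segments of length `ε n` in the direction of a nonzero step are a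
small multiple of `n`, uniformly over starting points within distance `n` of the origin. -/
def SmallSegmentsAt (p : AddGroupSeminorm G) (u : ι → G) (H : Ω → ℝ) (ω : Ω) : Prop :=
  ∀ η > 0, ∃ ε > (0 : ℝ), ∀ᶠ n : ℕ in atTop, ∀ x : G, p x ≤ n → ∀ i, u i ≠ 0 →
    ∀ m : ℕ, (m : ℝ) ≤ ε * n → ∑ k ∈ Finset.range (m + 1), H ((x + k • u i) +ᵥ ω) ≤ η * n

lemma SmallSegmentsAt.exists_eventually_le (h : SmallSegmentsAt p u H ω) (C : ℝ) {η : ℝ}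
    (hη : 0 < η) :
    ∃ ε > (0 : ℝ), ∀ᶠ n : ℕ in atTop, ∀ x : G, p x ≤ C * n → ∀ i, u i ≠ 0 →
      ∀ m : ℕ, (m : ℝ) ≤ ε * n → ∑ k ∈ Finset.range (m + 1), H ((x + k • u i) +ᵥ ω) ≤ η * n := by
  obtain ⟨D, hD⟩ := exists_nat_ge (max C 1)
  have hD1 : (1 : ℝ) ≤ D := (le_max_right _ _).trans hD
  have hD0 : (0 : ℝ) < D := by linarith
  obtain ⟨ε, hε, h1⟩ := h (η / D) (by positivity)
  refine ⟨ε, hε, ?_⟩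
  have h2 := (tendsto_id.const_mul_atTop' (show 0 < D by exact_mod_cast hD0)).eventually h1
  filter_upwards [h2] with n hn x hx i hi m hm
  have hnn : (0 : ℝ) ≤ n := Nat.cast_nonneg n
  simp only [id, Nat.cast_mul] at hn
  refine (hn x (hx.trans ?_) i hi m (hm.trans ?_)).trans_eq ?_
  · exact mul_le_mul_of_nonneg_right ((le_max_left _ _).trans hD) hnn
  · exact mul_le_mul_of_nonneg_left (le_mul_of_one_le_left hnn hD1) hε.le
  · field_simp

variable [Fintype ι] [DecidableEq ι] {F : (ι → ℕ) → Ω → ℝ}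

lemma displacement_sum_single (u : ι → G) (κ : ι → ℕ) (s : Finset ι) :
    displacement u (∑ i ∈ s, Pi.single i (κ i)) = ∑ i ∈ s, κ i • u i := by
  induction s using Finset.induction_on with
  | empty => simp [displacement]
  | insert i s hi ih =>
    rw [Finset.sum_insert hi, Finset.sum_insert hi, displacement_add, displacement_single, ih]

lemma SuperadditiveFamily.single_lower_bound (hF : SuperadditiveFamily u H F) (i : ι) (k : ℕ)
    (ω : Ω) : -∑ j ∈ Finset.range (k + 1), H ((j • u i) +ᵥ ω) ≤ F (Pi.single i k) ω := by
  induction k generalizing ω with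
  | zero => simpa using hF.zero_ge ω
  | succ k ih =>
    have h1 := hF.add_le (Pi.single i 1) (Pi.single i k) ω
    rw [← Pi.single_add, add_comm 1 k, displacement_single, one_smul] at h1
    have h2 := ih (u i +ᵥ ω)
    have h3 := hF.single_ge i ω
    rw [Finset.sum_range_succ']
    simp only [vadd_vadd, zero_smul, zero_vadd, ← succ_nsmul] at h2 ⊢
    linarith

lemma SuperadditiveFamily.sum_single_lower_bound (hF : SuperadditiveFamily u H F) (κ : ι → ℕ)
    (s : Finset ι) {B : ℝ} (h0 : H ω ≤ B)
    (h : ∀ t ⊆ s, ∀ i ∈ s, -B ≤ F (Pi.single i (κ i)) ((∑ j ∈ t, κ j • u j) +ᵥ ω)) :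
    -((s.card + 1) * B) ≤ F (∑ i ∈ s, Pi.single i (κ i)) ω := by
  induction s using Finset.induction_on with
  | empty =>
    have := hF.zero_ge ω
    simp only [Finset.card_empty, Nat.cast_zero, zero_add, one_mul, Finset.sum_empty]
    linarith
  | insert i s hi ih =>
    have h1 := ih fun t ht j hj => h t (ht.trans (Finset.subset_insert i s)) j
      (Finset.mem_insert_of_mem hj)
    have h2 := hF.add_le (∑ i ∈ s, Pi.single i (κ i)) (Pi.single i (κ i)) ω
    have h3 := h s (Finset.subset_insert i s) i (Finset.mem_insert_self i s)
    rw [displacement_sum_single] at h2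
    rw [Finset.sum_insert hi, Finset.card_insert_of_notMem hi,
      add_comm (Pi.single i (κ i) : ι → ℕ)]
    push_cast
    linarith

/-- A path with short, comparable step counts costs at most `η n`. Nonzero steps are used along
straight segments. Zero steps are spent at a site of one of these segments where `H` is below its
average over the segment; this is why the counts have to be comparable. -/
lemma SuperadditiveFamily.exists_connection_cost (hF : SuperadditiveFamily u H F)
    (hseg : SmallSegmentsAt p u H ω) {A C η : ℝ} (hA : 0 ≤ A)
    (hC : 0 ≤ C) (hη : 0 < η) :
    ∃ δ > (0 : ℝ), ∀ᶠ n : ℕ in atTop, ∀ κ₀ κ : ι → ℕ, (∀ i, (κ₀ i : ℝ) ≤ C * n) →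
      (∀ i, (κ i : ℝ) ≤ δ * n) → (∀ i j, (κ i : ℝ) ≤ A * (κ j + 1)) →
        -(η * n) ≤ F κ (displacement u κ₀ +ᵥ ω) := by
  classical
  set L : ℝ := (Fintype.card ι : ℝ) + 1 with hL
  have hL1 : (1 : ℝ) ≤ L := by simp [hL]
  have hcard : ∀ s : Finset ι, (s.card : ℝ) + 1 ≤ L := fun s => by
    have : s.card ≤ Fintype.card ι := Finset.card_le_univ s
    rw [hL]
    exact add_le_add (by exact_mod_cast this) le_rfl
  -- If all steps vanish, every path stays at the origin and the class condition is void.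
  by_cases hu : ∀ i, u i = 0
  · have hdisp : ∀ κ, displacement u κ = 0 := fun κ => by simp [displacement, hu]
    have hH0 := hF.bound_nonneg ω
    set δ : ℝ := η / L / (2 * (H ω + 1)) with hδ
    have hδ0 : 0 < δ := by positivity
    refine ⟨δ, hδ0, ?_⟩
    filter_upwards [(tendsto_natCast_atTop_atTop.const_mul_atTop
      (half_pos (div_pos hη (zero_lt_one.trans_le hL1)))).eventually_ge_atTop (H ω)]
      with n hn κ₀ κ _ hκ _
    have hB : (δ * n + 1) * H ω ≤ η / L * n := by
      have h1 : δ * (H ω + 1) = η / L / 2 := by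
        rw [hδ]; field_simp
      have h2 : δ * n * H ω ≤ η / L / 2 * n := by
        rw [← h1]
        nlinarith [mul_nonneg hδ0.le (Nat.cast_nonneg (α := ℝ) n)]
      linarith
    have h3 := hF.sum_single_lower_bound κ Finset.univ (ω := ω) (B := η / L * n) (by
      refine le_trans ?_ hB
      have := mul_nonneg (mul_nonneg hδ0.le (Nat.cast_nonneg (α := ℝ) n)) hH0
      linarith) (fun t _ i _ => by
        have h4 := hF.single_lower_bound i (κ i) ω
        simp only [hu, smul_zero, Finset.sum_const_zero, zero_vadd, Finset.sum_const,
          Finset.card_range, nsmul_eq_mul] at h4 ⊢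
        push_cast at h4
        have h5 : ((κ i : ℝ) + 1) * H ω ≤ (δ * n + 1) * H ω :=
          mul_le_mul_of_nonneg_right (by linarith [hκ i]) hH0
        linarith)
    rw [Finset.univ_sum_single] at h3
    rw [hdisp, zero_vadd]
    refine le_trans ?_ h3
    have h6 := mul_le_mul_of_nonneg_right (hcard Finset.univ)
      (show 0 ≤ η / L * n by positivity)
    have h7 : L * (η / L * n) = η * n := by field_simp
    linarith
  · push Not at hu
    obtain ⟨i₀, hi₀⟩ := hu
    set S : ℝ := ∑ i, p (u i) with hS
    have hS0 : 0 ≤ S := Finset.sum_nonneg fun i _ => apply_nonneg p _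
    set e : ℝ := η / (L * (A + 4)) with he
    have he0 : 0 < e := by positivity
    obtain ⟨ε, hε, h1⟩ := hseg.exists_eventually_le (C * S + 2 * S) he0
    refine ⟨min ε 1, lt_min hε zero_lt_one, ?_⟩
    filter_upwards [h1] with n hn κ₀ κ hκ₀ hκδ hκA
    have hnn : (0 : ℝ) ≤ n := Nat.cast_nonneg n
    have hκε : ∀ i, (κ i : ℝ) ≤ ε * n := fun i =>
      (hκδ i).trans (mul_le_mul_of_nonneg_right (min_le_left _ _) hnn)
    have hκ1 : ∀ i, (κ i : ℝ) ≤ n := fun i =>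
      (hκδ i).trans ((mul_le_mul_of_nonneg_right (min_le_right _ _) hnn).trans_eq (one_mul _))
    set x := displacement u κ₀ with hx
    have hsum : ∀ (D : ℝ), 0 ≤ D → ∀ (t : Finset ι) (c : ι → ℕ), (∀ i, (c i : ℝ) ≤ D) →
        p (∑ i ∈ t, c i • u i) ≤ D * S := by
      intro D hD t c hc
      calc p (∑ i ∈ t, c i • u i) ≤ ∑ i ∈ t, p (c i • u i) := Finset.le_sum_of_subadditive p
            (map_zero p).le (fun a b => map_add_le_add p a b) t _
        _ ≤ ∑ i ∈ t, D * p (u i) := Finset.sum_le_sum fun i _ =>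
            (map_nsmul_le_mul p _ _).trans (mul_le_mul_of_nonneg_right (hc i) (apply_nonneg p _))
        _ ≤ ∑ i, D * p (u i) := Finset.sum_le_sum_of_subset_of_nonneg (Finset.subset_univ t)
            fun i _ _ => mul_nonneg hD (apply_nonneg p _)
        _ = D * S := by rw [hS, Finset.mul_sum]
    have hpx : p x ≤ C * S * n := by
      refine (hsum (C * n) (by positivity) Finset.univ κ₀ hκ₀).trans_eq (by ring)
    have hpi : ∀ k : ℕ, k ≤ κ i₀ → p (k • u i₀) ≤ S * n := by
      intro k hk
      have h2 : p (u i₀) ≤ S :=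
        Finset.single_le_sum (f := fun i => p (u i)) (fun i _ => apply_nonneg p _)
          (Finset.mem_univ i₀)
      have h3 : (k : ℝ) ≤ n := le_trans (by exact_mod_cast hk) (hκ1 i₀)
      have := map_nsmul_le_mul p k (u i₀)
      have := mul_le_mul h3 h2 (apply_nonneg p _) hnn
      linarith
    -- A site of the segment where `H` is at most its average.
    obtain ⟨k₀, hk₀, hk₀H⟩ : ∃ k₀ ≤ κ i₀, ((κ i₀ : ℝ) + 1) * H ((x + k₀ • u i₀) +ᵥ ω) ≤ e * n := by
      have h2 := hn x (by nlinarith [mul_nonneg hS0 hnn]) i₀ hi₀ (κ i₀) (hκε i₀)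
      by_contra! h3
      have h4 : ∑ k ∈ Finset.range (κ i₀ + 1), e * n / ((κ i₀ : ℝ) + 1) <
          ∑ k ∈ Finset.range (κ i₀ + 1), H ((x + k • u i₀) +ᵥ ω) := by
        refine Finset.sum_lt_sum_of_nonempty ⟨0, by simp⟩ fun k hk => ?_
        rw [div_lt_iff₀ (by positivity), mul_comm (H _)]
        exact h3 k (Nat.lt_succ_iff.1 (Finset.mem_range.1 hk))
      rw [Finset.sum_const, Finset.card_range, nsmul_eq_mul] at h4
      push_cast at h4
      rw [mul_div_cancel₀ _ (by positivity)] at h4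
      linarith
    obtain ⟨k₁, hk₁⟩ : ∃ k₁, κ i₀ = k₀ + k₁ := ⟨κ i₀ - k₀, by omega⟩
    set Z : Finset ι := Finset.univ.filter fun i => u i = 0 with hZ
    set N : Finset ι := Finset.univ.filter fun i => u i ≠ 0 ∧ i ≠ i₀ with hN
    set κZ : ι → ℕ := ∑ i ∈ Z, Pi.single i (κ i) with hκZ
    set κN : ι → ℕ := ∑ i ∈ N, Pi.single i (κ i) with hκN
    have hdec : κ = Pi.single i₀ k₀ + (κZ + (Pi.single i₀ k₁ + κN)) := by
      have h2 : κ = ∑ i, Pi.single i (κ i) := (Finset.univ_sum_single κ).symm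
      have h3 : (Finset.univ : Finset ι) = insert i₀ (Z ∪ N) := by
        ext i
        by_cases h : u i = 0 <;> by_cases h' : i = i₀ <;> simp [hZ, hN, h, h']
      have h4 : i₀ ∉ Z ∪ N := by simp [hZ, hN, hi₀]
      have h5 : Disjoint Z N := by
        rw [Finset.disjoint_left]
        intro i hi hi'
        simp only [hZ, hN, Finset.mem_filter] at hi hi'
        exact hi'.2.1 hi.2
      conv_lhs => rw [h2, h3, Finset.sum_insert h4, Finset.sum_union h5, hk₁, Pi.single_add]
      rw [← hκZ, ← hκN]
      abel
    set y := x + k₀ • u i₀ with hy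
    have hpy : p y ≤ C * S * n + S * n :=
      (map_add_le_add p _ _).trans (add_le_add hpx (hpi k₀ hk₀))
    have hHy : H (y +ᵥ ω) ≤ e * n := by
      refine le_trans ?_ hk₀H
      exact le_mul_of_one_le_left (hF.bound_nonneg _) (by simp)
    have hstraight : ∀ w : G, p w ≤ (C * S + 2 * S) * n → ∀ i, u i ≠ 0 → ∀ k : ℕ, (k : ℝ) ≤ ε * n →
        -(e * n) ≤ F (Pi.single i k) (w +ᵥ ω) := by
      intro w hw i hi k hk
      have h2 := hF.single_lower_bound i k (w +ᵥ ω)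
      have h3 := hn w hw i hi k hk
      simp only [vadd_vadd, add_comm _ w] at h2
      linarith
    have hk₀' : (k₀ : ℝ) ≤ ε * n := le_trans (by exact_mod_cast hk₀) (hκε i₀)
    have hk₁' : (k₁ : ℝ) ≤ ε * n := le_trans (by exact_mod_cast (by omega : k₁ ≤ κ i₀)) (hκε i₀)
    have hSn : 0 ≤ S * n := mul_nonneg hS0 hnn
    have c1 := hstraight x (by nlinarith) i₀ hi₀ k₀ hk₀'
    have c2 : -((Z.card + 1) * ((A + 1) * (e * n))) ≤ F κZ (y +ᵥ ω) := by
      refine hF.sum_single_lower_bound κ Z ?_ fun t ht i hi => ?_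
      · refine hHy.trans ?_
        nlinarith [mul_nonneg hA (mul_nonneg he0.le hnn)]
      · have h2 : ∑ j ∈ t, κ j • u j = 0 := Finset.sum_eq_zero fun j hj => by
          rw [(Finset.mem_filter.1 (ht hj)).2, smul_zero]
        have h3 := hF.single_lower_bound i (κ i) (y +ᵥ ω)
        simp only [(Finset.mem_filter.1 hi).2, smul_zero, zero_vadd, Finset.sum_const,
          Finset.card_range, nsmul_eq_mul] at h3
        push_cast at h3
        rw [h2, zero_vadd]
        have h4 : ((κ i : ℝ) + 1) * H (y +ᵥ ω) ≤ (A + 1) * ((κ i₀ + 1) * H (y +ᵥ ω)) := by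
          rw [← mul_assoc]
          refine mul_le_mul_of_nonneg_right ?_ (hF.bound_nonneg _)
          have := hκA i i₀
          have : (0 : ℝ) ≤ κ i₀ := Nat.cast_nonneg _
          linarith
        have h5 := mul_le_mul_of_nonneg_left hk₀H (show 0 ≤ A + 1 by linarith)
        linarith
    have c3 := hstraight y (by nlinarith) i₀ hi₀ k₁ hk₁'
    set w := y + k₁ • u i₀ with hw
    have hw' : w = x + κ i₀ • u i₀ := by rw [hw, hy, hk₁, add_smul, add_assoc]
    have hpw : p w ≤ C * S * n + S * n := by
      rw [hw']
      exact (map_add_le_add p _ _).trans (add_le_add hpx (hpi _ le_rfl))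
    have c4 : -((N.card + 1) * (e * n)) ≤ F κN (w +ᵥ ω) := by
      refine hF.sum_single_lower_bound κ N ?_ fun t ht i hi => ?_
      · have := hn w (by nlinarith) i₀ hi₀ 0 (by simpa using mul_nonneg hε.le hnn)
        simpa using this
      · rw [vadd_vadd]
        refine hstraight _ ?_ i (Finset.mem_filter.1 hi).2.1 _ (hκε i)
        have h2 := hsum n hnn t κ hκ1
        have := map_add_le_add p (∑ j ∈ t, κ j • u j) w
        nlinarith
    have d1 := hF.add_le (Pi.single i₀ k₀) (κZ + (Pi.single i₀ k₁ + κN)) (x +ᵥ ω)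
    have d2 := hF.add_le κZ (Pi.single i₀ k₁ + κN) (y +ᵥ ω)
    have d3 := hF.add_le (Pi.single i₀ k₁) κN (y +ᵥ ω)
    have hdZ : displacement u κZ = 0 := by
      rw [hκZ, displacement_sum_single]
      exact Finset.sum_eq_zero fun j hj => by rw [(Finset.mem_filter.1 hj).2, smul_zero]
    rw [← hdec, displacement_single, vadd_vadd, add_comm (k₀ • u i₀) x, ← hy] at d1
    rw [hdZ, zero_vadd] at d2
    rw [displacement_single, vadd_vadd, add_comm (k₁ • u i₀) y, ← hw] at d3
    have hen : 0 ≤ e * n := by positivity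
    have f1 := mul_le_mul_of_nonneg_right (hcard Z) (show 0 ≤ (A + 1) * (e * n) by positivity)
    have f2 := mul_le_mul_of_nonneg_right (hcard N) hen
    have f3 := mul_le_mul_of_nonneg_right hL1 hen
    have f4 : L * (A + 4) * (e * n) = η * n := by
      rw [he]; field_simp
    nlinarith

end Connect

/-! ### Limits along general sequences of step counts -/

/-- The candidate limit in direction `α`: the upper limit of the rates `Λ ⌊N α⌋ / N`. -/
def directionRate {ι : Type*} (Λ : (ι → ℕ) → EReal) (α : ι → ℝ) : EReal :=
  sSup {x | ∃ c : ℝ, x = c ∧ ∃ᶠ N : ℕ in atTop, ((c * N : ℝ) : EReal) < Λ fun i => ⌊N * α i⌋₊}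

lemma exists_slope_loss_le {c c' : ℝ} (h : c' < c) :
    ∃ η > (0 : ℝ), ∃ θ₁ > (0 : ℝ), ∀ θ, 0 < θ → θ ≤ θ₁ → c' ≤ (c - η) / (1 + θ) - η := by
  set η := (c - c') / 4 with hη
  have h0 : 0 < c - c' := by linarith
  refine ⟨η, by positivity, (c - c') / (2 * (|c' + η| + 1)), by positivity, fun θ hθ hθ1 => ?_⟩
  rw [le_sub_iff_add_le, le_div_iff₀ (by linarith)]
  have h1 : θ * (|c' + η| + 1) ≤ (c - c') / 2 := by
    refine (mul_le_mul_of_nonneg_right hθ1 (by positivity)).trans_eq ?_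
    field_simp
  have h2 : (c' + η) * θ ≤ |c' + η| * θ := mul_le_mul_of_nonneg_right (le_abs_self _) hθ.le
  nlinarith

lemma abs_natFloor_sub_le {x : ℝ} (hx : 0 ≤ x) : |(⌊x⌋₊ : ℝ) - x| ≤ 1 := by
  rw [abs_le]
  constructor
  · linarith [Nat.lt_floor_add_one x]
  · linarith [Nat.floor_le hx]

lemma eventually_one_le_floor {ι : Type*} [Finite ι] {α : ι → ℝ} (hα : ∀ i, 0 < α i) :
    ∀ᶠ N : ℕ in atTop, ∀ i, 1 ≤ ⌊N * α i⌋₊ := by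
  rw [eventually_all]
  intro i
  filter_upwards [(tendsto_natCast_atTop_atTop.atTop_mul_const (hα i)).eventually_ge_atTop 1]
    with N hN
  rwa [Nat.one_le_floor_iff]

lemma abs_nsmul_floor_sub_le {ι : Type*} {α : ι → ℝ} (hα : ∀ i, 0 < α i) (m N : ℕ) (i : ι) :
    |((m • fun i => ⌊N * α i⌋₊) i : ℝ) - (m * N : ℕ) * α i| ≤ m := by
  have h1 := abs_natFloor_sub_le (mul_nonneg (Nat.cast_nonneg N) (hα i).le)
  have h2 : ((m • fun i => ⌊N * α i⌋₊) i : ℝ) - (m * N : ℕ) * α i =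
      m * ((⌊N * α i⌋₊ : ℝ) - N * α i) := by
    simp only [Pi.smul_apply, smul_eq_mul]
    push_cast
    ring
  rw [h2, abs_mul, Nat.abs_cast]
  exact mul_le_of_le_one_right (Nat.cast_nonneg m) h1

section Compare

variable {G Ω ι : Type*} [AddCommGroup G] [AddAction G Ω] {p : AddGroupSeminorm G} {u : ι → G}
  {H : Ω → ℝ} {ω : Ω} [Fintype ι] [DecidableEq ι] {F : (ι → ℕ) → Ω → ℝ} {α : ι → ℝ}

/-- Step counts close to `n α` can be completed at small cost to any step counts close to
`(1 + θ) n α`. -/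
lemma SuperadditiveFamily.exists_forall_compare (hF : SuperadditiveFamily u H F)
    (hseg : SmallSegmentsAt p u H ω) (hα : ∀ i, 0 < α i) (hα1 : ∀ i, α i ≤ 1) {η : ℝ}
    (hη : 0 < η) :
    ∃ θ₀ > (0 : ℝ), ∀ θ, 0 < θ → θ ≤ θ₀ → ∃ τ > (0 : ℝ), ∀ᶠ n : ℕ in atTop, ∀ κ σ : ι → ℕ,
      (∀ i, |(κ i : ℝ) - n * α i| ≤ τ * n) → (∀ i, |(σ i : ℝ) - (1 + θ) * n * α i| ≤ τ * n) →
        F κ ω - η * n ≤ F σ ω := by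
  obtain ⟨a, ha0, ha1, ha⟩ : ∃ a > (0 : ℝ), a ≤ 1 ∧ ∀ i, a ≤ α i := by
    rcases isEmpty_or_nonempty ι with hι | hι
    · exact ⟨1, one_pos, le_rfl, fun i => hι.elim i⟩
    · obtain ⟨i, hi⟩ := Finite.exists_min α
      exact ⟨α i, hα i, hα1 i, hi⟩
  obtain ⟨δ, hδ, hconn⟩ := hF.exists_connection_cost hseg (A := 3 / a) (C := 2) (η := η)
    (by positivity) (by norm_num) hη
  -- The difference of the counts lies between `θ a n / 2` and `3 θ n / 2`, which makes its entries
  -- comparable with ratio `3 / a`.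
  refine ⟨min 1 (δ / 2), by positivity, fun θ hθ hθ1 => ⟨θ * a / 4, by positivity, ?_⟩⟩
  have hθ2 : θ ≤ 1 := hθ1.trans (min_le_left _ _)
  have hθ3 : θ ≤ δ / 2 := hθ1.trans (min_le_right _ _)
  filter_upwards [hconn] with n hn κ σ hκ hσ
  have hnn : (0 : ℝ) ≤ n := Nat.cast_nonneg n
  have hθn : 0 ≤ θ * n := by positivity
  have hθan : θ * n * a ≤ θ * n := mul_le_of_le_one_right hθn ha1
  have hbd : ∀ i, θ * n * a / 2 ≤ (σ i : ℝ) - κ i ∧ (σ i : ℝ) - κ i ≤ 3 / 2 * (θ * n) := by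
    intro i
    have h1 := abs_le.1 (hκ i)
    have h2 := abs_le.1 (hσ i)
    have h3 : θ * n * a ≤ θ * n * α i := mul_le_mul_of_nonneg_left (ha i) hθn
    have h4 : θ * n * α i ≤ θ * n := mul_le_of_le_one_right hθn (hα1 i)
    constructor <;> nlinarith
  have hle : κ ≤ σ := fun i => by
    have h1 := (hbd i).1
    have h2 : 0 ≤ θ * n * a / 2 := by positivity
    exact_mod_cast (by linarith : (κ i : ℝ) ≤ σ i)
  obtain ⟨κ', hκ'⟩ : ∃ κ', σ = κ + κ' := ⟨σ - κ, (add_tsub_cancel_of_le hle).symm⟩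
  have hcast : ∀ i, (κ' i : ℝ) = σ i - κ i := fun i => by rw [hκ']; simp
  have h1 := hn κ κ' (fun i => by
      have h1 := (abs_le.1 (hκ i)).2
      have h2 : (n : ℝ) * α i ≤ n := mul_le_of_le_one_right hnn (hα1 i)
      nlinarith)
    (fun i => by
      rw [hcast]
      have := (hbd i).2
      have := mul_le_mul_of_nonneg_right hθ3 hnn
      nlinarith)
    (fun i j => by
      rw [hcast, hcast, div_mul_eq_mul_div, le_div_iff₀ ha0]
      have h2 := (hbd i).2
      have h3 := (hbd j).1
      have h4 := mul_le_mul_of_nonneg_right h2 ha0.le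
      nlinarith)
  have h2 := hF.add_le κ κ' ω
  rw [← hκ'] at h2
  linarith

variable {κ : ℕ → ι → ℕ} {C : ℝ} {Λ : (ι → ℕ) → EReal}

/-- Lower comparison: extending a path with counts `m ⌊N α⌋`, where `m N` is just below
`n / (1 + θ)`, to the counts `κ n` bounds the family along `κ` from below by the rate at `⌊N α⌋`. -/
lemma SuperadditiveFamily.eventually_ge_of_lt_rate (hF : SuperadditiveFamily u H F)
    (hseg : SmallSegmentsAt p u H ω) (hα : ∀ i, 0 < α i) (hα1 : ∀ i, α i ≤ 1)
    (hΛ : ∀ κ : ι → ℕ, (∀ i, 1 ≤ κ i) →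
      Tendsto (fun m : ℕ => ((F (m • κ) ω / m : ℝ) : EReal)) atTop (𝓝 (Λ κ)))
    (hκ : ∀ n i, |(κ n i : ℝ) - n * α i| ≤ C) {η : ℝ} (hη : 0 < η) :
    ∃ θ₀ > (0 : ℝ), ∀ θ, 0 < θ → θ ≤ θ₀ → ∀ᶠ N : ℕ in atTop, ∀ c : ℝ,
      ((c * N : ℝ) : EReal) < Λ (fun i => ⌊N * α i⌋₊) →
        ∀ᶠ n : ℕ in atTop, ((c - η) / (1 + θ) - η) * n ≤ F (κ n) ω := by
  obtain ⟨θ₀, hθ₀, hcomp⟩ := hF.exists_forall_compare hseg hα hα1 hη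
  refine ⟨θ₀, hθ₀, fun θ hθ hθ1 => ?_⟩
  obtain ⟨τ, hτ, hcomp⟩ := hcomp θ hθ hθ1
  filter_upwards [tendsto_natCast_atTop_atTop.eventually_ge_atTop (1 / τ),
    eventually_one_le_floor hα, eventually_ge_atTop 1] with N hN hN1 hN2 c hc
  have hN0 : (0 : ℝ) < N := by exact_mod_cast hN2
  have hr : (0 : ℝ) < (1 + θ) * N := by positivity
  set m : ℕ → ℕ := fun n => ⌊n / ((1 + θ) * N)⌋₊ with hm
  have hmt : Tendsto m atTop atTop :=
    tendsto_nat_floor_atTop.comp (tendsto_natCast_atTop_atTop.atTop_div_const hr)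
  have hmNt : Tendsto (fun n => m n * N) atTop atTop :=
    hmt.atTop_mul_const' hN2
  have h1 := hmt.eventually ((hΛ _ hN1).eventually (lt_mem_nhds hc))
  have h2 := hmNt.eventually hcomp
  have h3 : ∀ᶠ n : ℕ in atTop, C + (1 + θ) * N ≤ τ * (m n * N : ℕ) :=
    ((tendsto_natCast_atTop_atTop.comp hmNt).const_mul_atTop hτ).eventually_ge_atTop _
  have h4 : ∀ᶠ n : ℕ in atTop, |c - η| * N ≤ η * n :=
    (tendsto_natCast_atTop_atTop.const_mul_atTop hη).eventually_ge_atTop _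
  filter_upwards [h1, h2, h3, h4, hmt.eventually_ge_atTop 1] with n h1 h2 h3 h4 h5
  have hm0 : (0 : ℝ) < m n := by exact_mod_cast h5
  have hfl : (m n : ℝ) * ((1 + θ) * N) ≤ n := by
    rw [← le_div_iff₀ hr]
    exact Nat.floor_le (by positivity)
  have hfu : (n : ℝ) < (m n + 1) * ((1 + θ) * N) := by
    rw [← div_lt_iff₀ hr]
    exact Nat.lt_floor_add_one _
  have h6 := h2 (m n • fun i => ⌊N * α i⌋₊) (κ n)
    (fun i => (abs_nsmul_floor_sub_le hα (m n) N i).trans (by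
      push_cast
      rw [div_le_iff₀ hτ] at hN
      nlinarith))
    (fun i => by
      refine le_trans ?_ h3
      have h7 : (κ n i : ℝ) - (1 + θ) * (m n * N : ℕ) * α i =
          (κ n i - n * α i) + (n - (1 + θ) * (m n * N : ℕ)) * α i := by ring
      rw [h7]
      refine (abs_add_le _ _).trans (add_le_add (hκ n i) ?_)
      push_cast
      rw [abs_mul, abs_of_nonneg (by nlinarith), abs_of_nonneg (hα i).le]
      refine (mul_le_of_le_one_right (by nlinarith) (hα1 i)).trans (by nlinarith))
  have h7 : c * N * m n < F (m n • fun i => ⌊N * α i⌋₊) ω := by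
    rw [← lt_div_iff₀ hm0]
    exact EReal.coe_lt_coe_iff.1 h1
  push_cast at h6
  have h8 : (c - η) * (m n * N) ≤ F (κ n) ω := by nlinarith
  refine le_trans ?_ h8
  have h9 : (c - η) * (n / (1 + θ) - m n * N) ≤ |c - η| * N := by
    have e1 : n / (1 + θ) - m n * N = (n - m n * ((1 + θ) * N)) / (1 + θ) := by
      field_simp
    have e2 : 0 ≤ n / (1 + θ) - m n * N := by
      rw [e1]
      exact div_nonneg (by linarith) (by linarith)
    have e3 : n / (1 + θ) - m n * N ≤ N := by
      rw [e1, div_le_iff₀ (by linarith)]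
      nlinarith
    exact mul_le_mul (le_abs_self _) e3 e2 (abs_nonneg _)
  have h10 : (c - η) / (1 + θ) * n = (c - η) * (n / (1 + θ)) := by ring
  nlinarith

/-- Upper comparison: extending a path with counts `κ n` to the counts `m ⌊N α⌋`, where `m N` is just
above `(1 + θ) n`, bounds the rate at `⌊N α⌋` from below by the growth of the family along `κ`. -/
lemma SuperadditiveFamily.eventually_rate_ge (hF : SuperadditiveFamily u H F)
    (hseg : SmallSegmentsAt p u H ω) (hα : ∀ i, 0 < α i) (hα1 : ∀ i, α i ≤ 1)
    (hΛ : ∀ κ : ι → ℕ, (∀ i, 1 ≤ κ i) →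
      Tendsto (fun m : ℕ => ((F (m • κ) ω / m : ℝ) : EReal)) atTop (𝓝 (Λ κ)))
    (hκ : ∀ n i, |(κ n i : ℝ) - n * α i| ≤ C) {η : ℝ} (hη : 0 < η) :
    ∃ θ₀ > (0 : ℝ), ∀ θ, 0 < θ → θ ≤ θ₀ → ∀ᶠ N : ℕ in atTop, ∀ c : ℝ,
      (∃ᶠ n : ℕ in atTop, c * n ≤ F (κ n) ω) →
        ((((c - η) / (1 + θ) - η) * N : ℝ) : EReal) ≤ Λ (fun i => ⌊N * α i⌋₊) := by
  obtain ⟨θ₀, hθ₀, hcomp⟩ := hF.exists_forall_compare hseg hα hα1 hη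
  refine ⟨min θ₀ 1, lt_min hθ₀ one_pos, fun θ hθ hθ1 => ?_⟩
  have hθ2 : θ ≤ 1 := hθ1.trans (min_le_right _ _)
  obtain ⟨τ, hτ, hcomp⟩ := hcomp θ hθ (hθ1.trans (min_le_left _ _))
  filter_upwards [tendsto_natCast_atTop_atTop.eventually_ge_atTop (4 / τ),
    eventually_one_le_floor hα, eventually_ge_atTop 1] with N hN hN1 hN2 c hc
  have hN0 : (0 : ℝ) < N := by exact_mod_cast hN2
  set m : ℕ → ℕ := fun n => ⌈(1 + θ) / N * n⌉₊ with hm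
  have hmt : Tendsto m atTop atTop :=
    tendsto_nat_ceil_atTop.comp (tendsto_natCast_atTop_atTop.const_mul_atTop (by positivity))
  by_contra! hlt
  have h1 := hmt.eventually ((hΛ _ hN1).eventually (gt_mem_nhds hlt))
  have h3 : ∀ᶠ n : ℕ in atTop, 1 + N ≤ τ / 2 * n :=
    (tendsto_natCast_atTop_atTop.const_mul_atTop (by positivity)).eventually_ge_atTop _
  have h3' : ∀ᶠ n : ℕ in atTop, C ≤ τ * n :=
    (tendsto_natCast_atTop_atTop.const_mul_atTop (by positivity)).eventually_ge_atTop _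
  have h4 : ∀ᶠ n : ℕ in atTop, |c - η| * N ≤ η * n :=
    (tendsto_natCast_atTop_atTop.const_mul_atTop hη).eventually_ge_atTop _
  have h5 := hmt.eventually_ge_atTop 1
  obtain ⟨n, hcn, h1, h2, h3, h3', h4, h5⟩ := (hc.and_eventually
    (h1.and (hcomp.and (h3.and (h3'.and (h4.and h5)))))).exists
  have hnn : (0 : ℝ) ≤ n := Nat.cast_nonneg n
  have hm0 : (0 : ℝ) < m n := by exact_mod_cast h5
  have hfl : (1 + θ) * n ≤ m n * N := by
    rw [← div_le_iff₀ hN0, ← div_mul_eq_mul_div]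
    exact Nat.le_ceil _
  have hfu : (m n : ℝ) * N ≤ (1 + θ) * n + N := by
    have h6 : (m n : ℝ) < (1 + θ) / N * n + 1 := Nat.ceil_lt_add_one (by positivity)
    have h7 := (mul_lt_mul_of_pos_right h6 hN0).le
    have h8 : ((1 + θ) / N * n + 1) * N = (1 + θ) * n + N := by field_simp
    linarith
  have hmτ : (m n : ℝ) ≤ τ / 2 * n + 1 := by
    have h6 : (m n : ℝ) < (1 + θ) / N * n + 1 := Nat.ceil_lt_add_one (by positivity)
    have h7 : (1 + θ) / N ≤ τ / 2 := by
      rw [div_le_iff₀ hN0]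
      rw [div_le_iff₀ hτ] at hN
      nlinarith
    nlinarith [mul_le_mul_of_nonneg_right h7 hnn]
  have h6 := h2 (κ n) (m n • fun i => ⌊N * α i⌋₊) (fun i => (hκ n i).trans h3') (fun i => by
    have h7 : ((m n • fun i => ⌊N * α i⌋₊) i : ℝ) - (1 + θ) * n * α i =
        ((m n • fun i => ⌊N * α i⌋₊) i - (m n * N : ℕ) * α i) +
          (m n * N - (1 + θ) * n) * α i := by push_cast; ring
    rw [h7]
    refine (abs_add_le _ _).trans ((add_le_add (abs_nsmul_floor_sub_le hα (m n) N i) ?_).trans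
      (by linarith : (m n : ℝ) + N ≤ τ * n))
    rw [abs_mul, abs_of_nonneg (by linarith), abs_of_nonneg (hα i).le]
    exact (mul_le_of_le_one_right (by linarith) (hα1 i)).trans (by linarith))
  have h7 : F (m n • fun i => ⌊N * α i⌋₊) ω < ((c - η) / (1 + θ) - η) * N * m n := by
    rw [← div_lt_iff₀ hm0]
    exact EReal.coe_lt_coe_iff.1 h1
  have h8 : (c - η) / (1 + θ) * (m n * N) ≤ (c - η) * n + |c - η| * N := by
    have e1 : (c - η) / (1 + θ) * (m n * N) =
        (c - η) * n + (c - η) * ((m n * N - (1 + θ) * n) / (1 + θ)) := by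
      field_simp
      ring
    rw [e1]
    refine add_le_add le_rfl (mul_le_mul (le_abs_self _) ?_ ?_ (abs_nonneg _))
    · rw [div_le_iff₀ (by linarith)]
      nlinarith
    · exact div_nonneg (by linarith) (by linarith)
  have h9 : η * n ≤ η * (m n * N) := mul_le_mul_of_nonneg_left (by nlinarith) hη.le
  nlinarith

/-- Along every sequence of step counts within bounded distance of `n α` the family has the rate
`directionRate Λ α`, which depends neither on the sequence nor on the environment. -/
theorem SuperadditiveFamily.tendsto_directionRate (hF : SuperadditiveFamily u H F)
    (hseg : SmallSegmentsAt p u H ω) (hα : ∀ i, 0 < α i) (hα1 : ∀ i, α i ≤ 1)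
    (hΛ : ∀ κ : ι → ℕ, (∀ i, 1 ≤ κ i) →
      Tendsto (fun m : ℕ => ((F (m • κ) ω / m : ℝ) : EReal)) atTop (𝓝 (Λ κ)))
    (hΛbot : ∀ κ : ι → ℕ, (∀ i, 1 ≤ κ i) → ⊥ < Λ κ)
    (hκ : ∀ n i, |(κ n i : ℝ) - n * α i| ≤ C) :
    ⊥ < directionRate Λ α ∧
      Tendsto (fun n : ℕ => ((F (κ n) ω / n : ℝ) : EReal)) atTop (𝓝 (directionRate Λ α)) := by
  have hlo : ∀ c c' : ℝ, c' < c → ∀ᶠ N : ℕ in atTop,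
      ((c * N : ℝ) : EReal) < Λ (fun i => ⌊N * α i⌋₊) →
        ∀ᶠ n : ℕ in atTop, c' * n ≤ F (κ n) ω := by
    intro c c' hcc
    obtain ⟨η, hη, θ₁, hθ₁, h1⟩ := exists_slope_loss_le hcc
    obtain ⟨θ₀, hθ₀, h2⟩ := hF.eventually_ge_of_lt_rate hseg hα hα1 hΛ hκ hη
    have h3 : 0 < min θ₀ θ₁ := lt_min hθ₀ hθ₁
    filter_upwards [h2 _ h3 (min_le_left _ _)] with N hN hc
    filter_upwards [hN c hc] with n hn
    exact (mul_le_mul_of_nonneg_right (h1 _ h3 (min_le_right _ _)) (Nat.cast_nonneg n)).trans hn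
  have hup : ∀ c c' : ℝ, c' < c → (∃ᶠ n : ℕ in atTop, c * n ≤ F (κ n) ω) →
      ∀ᶠ N : ℕ in atTop, ((c' * N : ℝ) : EReal) ≤ Λ (fun i => ⌊N * α i⌋₊) := by
    intro c c' hcc hc
    obtain ⟨η, hη, θ₁, hθ₁, h1⟩ := exists_slope_loss_le hcc
    obtain ⟨θ₀, hθ₀, h2⟩ := hF.eventually_rate_ge hseg hα hα1 hΛ hκ hη
    have h3 : 0 < min θ₀ θ₁ := lt_min hθ₀ hθ₁
    filter_upwards [h2 _ h3 (min_le_left _ _)] with N hN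
    refine le_trans (EReal.coe_le_coe_iff.2 ?_) (hN c hc)
    exact mul_le_mul_of_nonneg_right (h1 _ h3 (min_le_right _ _)) (Nat.cast_nonneg N)
  have hmem : ∀ c c' : ℝ, c' < c → (∃ᶠ n : ℕ in atTop, c * n ≤ F (κ n) ω) →
      (c' : EReal) ≤ directionRate Λ α := by
    intro c c' hcc hc
    obtain ⟨r, hr1, hr2⟩ := exists_between hcc
    refine le_sSup ⟨c', rfl, Eventually.frequently ?_⟩
    filter_upwards [hup c r hr2 hc, eventually_ge_atTop 1] with N hN hN1
    refine lt_of_lt_of_le (EReal.coe_lt_coe_iff.2 ?_) hN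
    exact mul_lt_mul_of_pos_right hr1 (by exact_mod_cast hN1)
  constructor
  · obtain ⟨θ₀, hθ₀, h2⟩ := hF.eventually_ge_of_lt_rate hseg hα hα1 hΛ hκ one_pos
    obtain ⟨N, hN, hN1, hN2⟩ := ((h2 θ₀ hθ₀ le_rfl).and
      ((eventually_one_le_floor hα).and (eventually_ge_atTop 1))).exists
    obtain ⟨c, -, hc⟩ := EReal.lt_iff_exists_real_btwn.1 (hΛbot _ hN1)
    have hN0 : (N : ℝ) ≠ 0 := by exact_mod_cast (by omega : N ≠ 0)
    have h3 := hN (c / N) (by rwa [div_mul_cancel₀ _ hN0])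
    exact (EReal.bot_lt_coe _).trans_le (hmem _ _ (sub_one_lt _) h3.frequently)
  · refine tendsto_order.2 ⟨fun x hx => ?_, fun x hx => ?_⟩
    · obtain ⟨_, ⟨c, rfl, hc⟩, hxc⟩ := lt_sSup_iff.1 hx
      obtain ⟨c', hc1, hc2⟩ := EReal.lt_iff_exists_real_btwn.1 hxc
      obtain ⟨N, hN, hN'⟩ := (hc.and_eventually (hlo c c' (EReal.coe_lt_coe_iff.1 hc2))).exists
      filter_upwards [hN' hN, eventually_ge_atTop 1] with n hn hn1
      refine hc1.trans_le (EReal.coe_le_coe_iff.2 ?_)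
      rwa [le_div_iff₀ (by exact_mod_cast hn1)]
    · obtain ⟨c, hc1, hc2⟩ := EReal.lt_iff_exists_real_btwn.1 hx
      obtain ⟨c', hc1', hc2'⟩ := EReal.lt_iff_exists_real_btwn.1 hc1
      have h1 : ¬ ∃ᶠ n : ℕ in atTop, c * n ≤ F (κ n) ω := fun h =>
        (hmem c c' (EReal.coe_lt_coe_iff.1 hc2') h).not_gt hc1'
      filter_upwards [not_frequently.1 h1, eventually_ge_atTop 1] with n hn hn1
      refine lt_of_le_of_lt (EReal.coe_le_coe_iff.2 ?_) hc2
      rw [div_le_iff₀ (by exact_mod_cast hn1)]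
      exact (not_le.1 hn).le

end Compare

/-! ### Partition functions over finite words -/

section Words

variable {d : ℕ} {R : Finset (Fin d → ℤ)} {Ω : Type*} {ℓ : ℕ}

/-- The sum of the absolute values of the potential at `ω` over all step blocks. -/
def totalPotential (g : Ω × (Fin ℓ → R) → ℝ) (ω : Ω) : ℝ := ∑ z', |g (ω, z')|

lemma totalPotential_nonneg (g : Ω × (Fin ℓ → R) → ℝ) (ω : Ω) : 0 ≤ totalPotential g ω :=
  Finset.sum_nonneg fun _ _ => abs_nonneg _

lemma abs_le_totalPotential (g : Ω × (Fin ℓ → R) → ℝ) (ω : Ω) (z' : Fin ℓ → R) :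
    |g (ω, z')| ≤ totalPotential g ω :=
  Finset.single_le_sum (f := fun z' => |g (ω, z')|) (fun _ _ => abs_nonneg _) (Finset.mem_univ z')

lemma position_add (s : ℕ → R) (m n : ℕ) :
    position s (m + n) = position s m + position (fun i => s (m + i)) n := by
  simp [position, Finset.sum_range_add]

lemma position_congr {s s' : ℕ → R} {n : ℕ} (h : ∀ i < n, s i = s' i) :
    position s n = position s' n :=
  Finset.sum_congr rfl fun i hi => by rw [h i (Finset.mem_range.1 hi)]

variable [AddAction (StepGroup R) Ω]

lemma energy_add (g : Ω × (Fin ℓ → R) → ℝ) (ω : Ω) (m n : ℕ) (s : ℕ → R) :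
    energy g ω (m + n) s =
      energy g ω m s + energy g (position s m +ᵥ ω) n (fun i => s (m + i)) := by
  simp only [energy, Finset.sum_range_add]
  congr 1
  refine Finset.sum_congr rfl fun k _ => ?_
  rw [position_add, vadd_vadd, add_comm (position s m)]
  congr 2
  funext j
  simp only [stepBlock, add_assoc]

/-- A bound for the change of the energy of a path ending at the origin when the steps after its end
are changed: only the last `ℓ` sites are affected, and these are reached backwards by at most `ℓ`
steps. -/
def boundaryBound (g : Ω × (Fin ℓ → R) → ℝ) (ω : Ω) : ℝ :=
  ∑ j ∈ Finset.range (ℓ + 1), ∑ w : Fin j → R,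
    2 * totalPotential g ((-∑ i, step (w i)) +ᵥ ω)

lemma boundaryBound_nonneg (g : Ω × (Fin ℓ → R) → ℝ) (ω : Ω) : 0 ≤ boundaryBound g ω :=
  Finset.sum_nonneg fun _ _ => Finset.sum_nonneg fun _ _ =>
    mul_nonneg zero_le_two (totalPotential_nonneg g _)

lemma abs_energy_sub_le (g : Ω × (Fin ℓ → R) → ℝ) (ω : Ω) {n : ℕ} {s s' : ℕ → R}
    (h : ∀ i < n, s i = s' i) :
    |energy g ω n s - energy g ω n s'| ≤ boundaryBound g (position s n +ᵥ ω) := by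
  set Φ : ℕ → ℝ := fun j => ∑ w : Fin j → R,
    2 * totalPotential g ((-∑ i, step (w i)) +ᵥ (position s n +ᵥ ω)) with hΦ
  have hΦ0 : ∀ j, 0 ≤ Φ j := fun j => Finset.sum_nonneg fun _ _ =>
    mul_nonneg zero_le_two (totalPotential_nonneg g _)
  have hterm : ∀ k ∈ Finset.range n,
      |g (position s k +ᵥ ω, stepBlock ℓ s k) - g (position s' k +ᵥ ω, stepBlock ℓ s' k)| ≤
        if n < k + ℓ then Φ (n - k) else 0 := by
    intro k hk
    have hkn := Finset.mem_range.1 hk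
    rw [position_congr fun i hi => (h i (hi.trans hkn)).symm]
    split_ifs with hkl
    · have h1 : position s k +ᵥ ω =
          (-∑ i : Fin (n - k), step (s (k + i))) +ᵥ (position s n +ᵥ ω) := by
        have h2 : position s n = position s k + ∑ i : Fin (n - k), step (s (k + i)) := by
          have h3 := position_add s k (n - k)
          rw [Nat.add_sub_cancel' hkn.le] at h3
          rw [h3, position, position, Fin.sum_univ_eq_sum_range (fun i => step (s (k + i)))]
        rw [vadd_vadd, h2, add_comm (position s k), neg_add_cancel_left]
      have h2 : 2 * totalPotential g (position s k +ᵥ ω) ≤ Φ (n - k) := by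
        rw [h1]
        exact Finset.single_le_sum (f := fun w : Fin (n - k) → R =>
          2 * totalPotential g ((-∑ i, step (w i)) +ᵥ (position s n +ᵥ ω)))
          (fun _ _ => mul_nonneg zero_le_two (totalPotential_nonneg g _))
          (Finset.mem_univ fun i : Fin (n - k) => s (k + i))
      refine (abs_sub _ _).trans (le_trans ?_ h2)
      linarith [abs_le_totalPotential g (position s k +ᵥ ω) (stepBlock ℓ s k),
        abs_le_totalPotential g (position s k +ᵥ ω) (stepBlock ℓ s' k)]
    · have h1 : stepBlock ℓ s k = stepBlock ℓ s' k := by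
        funext j
        exact h _ (by have := j.2; omega)
      rw [h1, sub_self, abs_zero]
  calc |energy g ω n s - energy g ω n s'|
      ≤ ∑ k ∈ Finset.range n, if n < k + ℓ then Φ (n - k) else 0 := by
        rw [energy, energy, ← Finset.sum_sub_distrib]
        exact (Finset.abs_sum_le_sum_abs _ _).trans (Finset.sum_le_sum hterm)
    _ = ∑ j ∈ ((Finset.range n).filter fun k => n < k + ℓ).image (fun k => n - k), Φ j := by
        rw [← Finset.sum_filter, Finset.sum_image]
        intro a ha b hb hab
        have h1 := Finset.mem_range.1 (Finset.mem_filter.1 ha).1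
        have h2 := Finset.mem_range.1 (Finset.mem_filter.1 hb).1
        simp only at hab
        omega
    _ ≤ ∑ j ∈ Finset.range (ℓ + 1), Φ j := by
        refine Finset.sum_le_sum_of_subset_of_nonneg (fun j hj => ?_) fun j _ _ => hΦ0 j
        obtain ⟨k, hk, rfl⟩ := Finset.mem_image.1 hj
        have := (Finset.mem_filter.1 hk).2
        exact Finset.mem_range.2 (by omega)

variable [Nonempty R]

/-- The infinite sequence of steps that continues a finite word by a fixed step. -/
def extendWord {n : ℕ} (w : Fin n → R) : ℕ → R :=
  fun i => if h : i < n then w ⟨i, h⟩ else Classical.arbitrary R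

lemma extendWord_of_lt {n : ℕ} (w : Fin n → R) {i : ℕ} (h : i < n) :
    extendWord w i = w ⟨i, h⟩ := dif_pos h

lemma extendWord_append_left {m n : ℕ} (w : Fin m → R) (w' : Fin n → R) {i : ℕ} (h : i < m) :
    extendWord (Fin.append w w') i = extendWord w i := by
  rw [extendWord_of_lt _ (h.trans_le (Nat.le_add_right m n)), extendWord_of_lt _ h]
  exact Fin.append_left w w' ⟨i, h⟩

lemma extendWord_append_right {m n : ℕ} (w : Fin m → R) (w' : Fin n → R) (i : ℕ) :
    extendWord (Fin.append w w') (m + i) = extendWord w' i := by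
  by_cases h : i < n
  · rw [extendWord_of_lt _ (Nat.add_lt_add_left h m), extendWord_of_lt _ h]
    exact Fin.append_right w w' ⟨i, h⟩
  · rw [extendWord, extendWord, dif_neg h, dif_neg (by omega)]

open scoped Classical in
/-- The contribution of a word to the point-to-point partition function. -/
def wordWeight (g : Ω × (Fin ℓ → R) → ℝ) (ω : Ω) {n : ℕ} (x : StepGroup R) (w : Fin n → R) : ℝ :=
  if position (extendWord w) n = x then Real.exp (energy g ω n (extendWord w)) else 0

/-- The point-to-point partition function of words continued by a fixed step. -/
def wordPartition (g : Ω × (Fin ℓ → R) → ℝ) (n : ℕ) (x : StepGroup R) (ω : Ω) : ℝ :=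
  ((Fintype.card R : ℝ)⁻¹) ^ n * ∑ w : Fin n → R, wordWeight g ω x w

lemma wordWeight_nonneg (g : Ω × (Fin ℓ → R) → ℝ) (ω : Ω) {n : ℕ} (x : StepGroup R)
    (w : Fin n → R) : 0 ≤ wordWeight g ω x w := by
  rw [wordWeight]
  split_ifs
  exacts [(Real.exp_pos _).le, le_rfl]

/-- Concatenation of words: the energy of the first word changes by at most the boundary term, since
its blocks now see the second word instead of the fixed continuation. -/
lemma wordWeight_append_ge (g : Ω × (Fin ℓ → R) → ℝ) (ω : Ω) {m n : ℕ} (x y : StepGroup R)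
    (w : Fin m → R) (w' : Fin n → R) :
    wordWeight g ω x w * wordWeight g (x +ᵥ ω) y w' * Real.exp (-boundaryBound g (x +ᵥ ω)) ≤
      wordWeight g ω (x + y) (Fin.append w w') := by
  by_cases h1 : position (extendWord w) m = x
  swap
  · rw [wordWeight, if_neg h1, zero_mul, zero_mul]
    exact wordWeight_nonneg g ω _ _
  by_cases h2 : position (extendWord w') n = y
  swap
  · rw [wordWeight, wordWeight, if_neg h2, mul_zero, zero_mul]
    exact wordWeight_nonneg g ω _ _
  have h3 : position (extendWord (Fin.append w w')) m = x := by
    rw [← h1]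
    exact position_congr fun i hi => extendWord_append_left w w' hi
  have h4 : (fun i => extendWord (Fin.append w w') (m + i)) = extendWord w' :=
    funext (extendWord_append_right w w')
  have h5 : position (extendWord (Fin.append w w')) (m + n) = x + y := by
    rw [position_add, h3, h4, h2]
  have h6 := energy_add g ω m n (extendWord (Fin.append w w'))
  have h7 := abs_energy_sub_le g ω (n := m) (s := extendWord w)
    (s' := extendWord (Fin.append w w')) fun i hi => (extendWord_append_left w w' hi).symm
  rw [h3, h4] at h6
  rw [h1] at h7
  rw [wordWeight, wordWeight, wordWeight, if_pos h1, if_pos h2, if_pos h5, ← Real.exp_add,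
    ← Real.exp_add, Real.exp_le_exp]
  linarith [(abs_le.1 h7).2]

lemma wordPartition_mul_le (g : Ω × (Fin ℓ → R) → ℝ) (ω : Ω) (m n : ℕ) (x y : StepGroup R) :
    wordPartition g m x ω * wordPartition g n y (x +ᵥ ω) *
      Real.exp (-boundaryBound g (x +ᵥ ω)) ≤ wordPartition g (m + n) (x + y) ω := by
  have h1 : ∑ w : Fin (m + n) → R, wordWeight g ω (x + y) w =
      ∑ q : (Fin m → R) × (Fin n → R), wordWeight g ω (x + y) (Fin.append q.1 q.2) :=
    (Equiv.sum_comp (Fin.appendEquiv m n) _).symm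
  have h2 : (∑ w : Fin m → R, wordWeight g ω x w) * (∑ w : Fin n → R, wordWeight g (x +ᵥ ω) y w) *
      Real.exp (-boundaryBound g (x +ᵥ ω)) ≤ ∑ w : Fin (m + n) → R, wordWeight g ω (x + y) w := by
    rw [h1, Finset.sum_mul_sum, ← Finset.univ_product_univ, Finset.sum_product, Finset.sum_mul]
    refine Finset.sum_le_sum fun w _ => ?_
    rw [Finset.sum_mul]
    exact Finset.sum_le_sum fun w' _ => wordWeight_append_ge g ω x y w w'
  have h3 := mul_le_mul_of_nonneg_left h2
    (show 0 ≤ ((Fintype.card R : ℝ)⁻¹) ^ (m + n) by positivity)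
  rw [wordPartition, wordPartition, wordPartition]
  refine le_trans (le_of_eq ?_) h3
  rw [pow_add]
  ring

lemma wordPartition_zero (g : Ω × (Fin ℓ → R) → ℝ) (ω : Ω) : wordPartition g 0 0 ω = 1 := by
  simp [wordPartition, wordWeight, position, energy]

lemma card_pos : (0 : ℝ) < Fintype.card R := by exact_mod_cast Fintype.card_pos

lemma wordPartition_one_ge (g : Ω × (Fin ℓ → R) → ℝ) (ω : Ω) (z : R) :
    (Fintype.card R : ℝ)⁻¹ * Real.exp (-totalPotential g ω) ≤ wordPartition g 1 (step z) ω := by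
  rw [wordPartition, pow_one]
  refine mul_le_mul_of_nonneg_left ?_ (inv_nonneg.2 card_pos.le)
  have h1 : position (extendWord fun _ : Fin 1 => z) 1 = step z := by
    simp [position, extendWord]
  have h2 : Real.exp (-totalPotential g ω) ≤ wordWeight g ω (step z) (fun _ : Fin 1 => z) := by
    rw [wordWeight, if_pos h1, Real.exp_le_exp]
    have := neg_abs_le (g (ω, stepBlock ℓ (extendWord fun _ : Fin 1 => z) 0))
    have := abs_le_totalPotential g ω (stepBlock ℓ (extendWord fun _ : Fin 1 => z) 0)
    simp only [energy, Finset.sum_range_one, position, Finset.range_zero, Finset.sum_empty,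
      zero_vadd]
    linarith
  exact h2.trans (Finset.single_le_sum (f := fun w : Fin 1 → R => wordWeight g ω (step z) w)
    (fun w _ => wordWeight_nonneg g ω _ w) (Finset.mem_univ _))

variable {ι : Type*} [Fintype ι] [DecidableEq ι] (e : ι → R)

lemma wordPartition_pos (g : Ω × (Fin ℓ → R) → ℝ) (κ : ι → ℕ) (ω : Ω) :
    0 < wordPartition g (∑ i, κ i) (displacement (fun i => step (e i)) κ) ω := by
  induction hn : ∑ i, κ i generalizing κ ω with
  | zero =>
    have h1 : κ = 0 := by
      funext i
      exact (Finset.sum_eq_zero_iff.1 hn) i (Finset.mem_univ i)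
    have h2 : displacement (fun i => step (e i)) κ = 0 := by simp [displacement, h1]
    rw [h2, wordPartition_zero]
    exact one_pos
  | succ n ih =>
    obtain ⟨i, -, hi⟩ : ∃ i ∈ Finset.univ, κ i ≠ 0 :=
      Finset.exists_ne_zero_of_sum_ne_zero (by omega)
    obtain ⟨κ', rfl⟩ := exists_eq_single_add hi
    have h2 : ∑ j, κ' j = n := by
      simp only [Pi.add_apply, Finset.sum_add_distrib, Fintype.sum_pi_single'] at hn
      omega
    rw [displacement_add, displacement_single, one_smul, add_comm n 1]
    refine lt_of_lt_of_le ?_ (wordPartition_mul_le g ω 1 n (step (e i)) _)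
    refine mul_pos (mul_pos ?_ (ih κ' _ h2)) (Real.exp_pos _)
    exact lt_of_lt_of_le (mul_pos (inv_pos.2 card_pos) (Real.exp_pos _))
      (wordPartition_one_ge g ω (e i))

/-- The logarithm of the partition function of words at the end point of a path with step counts
`κ`, lowered by the boundary term so as to become exactly superadditive. -/
def logWordPartition (g : Ω × (Fin ℓ → R) → ℝ) (κ : ι → ℕ) (ω : Ω) : ℝ :=
  Real.log (wordPartition g (∑ i, κ i) (displacement (fun i => step (e i)) κ) ω) - boundaryBound g ω

/-- A bound for the cost of a single step in the superadditive family of partition functions. -/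
def stepCost (g : Ω × (Fin ℓ → R) → ℝ) (ω : Ω) : ℝ :=
  Real.log (Fintype.card R) + totalPotential g ω + boundaryBound g ω

theorem superadditiveFamily_logWordPartition (g : Ω × (Fin ℓ → R) → ℝ) :
    SuperadditiveFamily (fun i => step (e i)) (stepCost g) (logWordPartition e g) where
  bound_nonneg ω := by
    have h1 : 0 ≤ Real.log (Fintype.card R) :=
      Real.log_nonneg (by exact_mod_cast Fintype.card_pos (α := R))
    exact add_nonneg (add_nonneg h1 (totalPotential_nonneg g ω)) (boundaryBound_nonneg g ω)
  add_le κ κ' ω := by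
    set x := displacement (fun i => step (e i)) κ with hx
    have h1 := wordPartition_mul_le g ω (∑ i, κ i) (∑ i, κ' i) x
      (displacement (fun i => step (e i)) κ')
    have h2 := wordPartition_pos e g κ ω
    have h3 := wordPartition_pos e g κ' (x +ᵥ ω)
    have h4 := Real.log_le_log (mul_pos (mul_pos h2 h3) (Real.exp_pos _)) h1
    rw [Real.log_mul (mul_pos h2 h3).ne' (Real.exp_pos _).ne', Real.log_mul h2.ne' h3.ne',
      Real.log_exp] at h4
    simp only [logWordPartition, displacement_add, Pi.add_apply, Finset.sum_add_distrib]
    linarith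
  zero_ge ω := by
    have h1 : 0 ≤ Real.log (Fintype.card R) :=
      Real.log_nonneg (by exact_mod_cast Fintype.card_pos (α := R))
    have h2 : displacement (fun i => step (e i)) (0 : ι → ℕ) = 0 := by simp [displacement]
    simp only [logWordPartition, stepCost, h2, Pi.zero_apply, Finset.sum_const_zero,
      wordPartition_zero, Real.log_one]
    linarith [totalPotential_nonneg g ω]
  single_ge i ω := by
    have h1 := wordPartition_one_ge g ω (e i)
    have h2 := Real.log_le_log (mul_pos (inv_pos.2 card_pos) (Real.exp_pos _)) h1
    rw [Real.log_mul (inv_pos.2 card_pos).ne' (Real.exp_pos _).ne', Real.log_inv,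
      Real.log_exp] at h2
    simp only [logWordPartition, stepCost, displacement_single, one_smul, Fintype.sum_pi_single']
    linarith

/-! ### Comparison with the partition function of the walk -/

lemma lintegral_stepLaw_word (n : ℕ) (f : (Fin n → R) → ENNReal) :
    ∫⁻ s, f (fun i => s i) ∂(stepLaw R) = ∑ w, f w * ((Fintype.card R : ENNReal)⁻¹) ^ n := by
  have hm : Measurable fun (s : ℕ → R) (i : Fin n) => s i :=
    measurable_pi_lambda _ fun i => measurable_pi_apply _
  rw [← lintegral_map (f := f) (measurable_of_countable f) hm, lintegral_fintype]
  refine Finset.sum_congr rfl fun w _ => ?_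
  congr 1
  rw [Measure.map_apply hm (measurableSet_singleton w)]
  have h1 : (fun (s : ℕ → R) (i : Fin n) => s i) ⁻¹' {w} =
      Set.pi (Finset.range n : Set ℕ) fun i => {extendWord w i} := by
    ext s
    simp only [Set.mem_preimage, Set.mem_singleton_iff, Set.mem_pi, Finset.coe_range, Set.mem_Iio]
    constructor
    · rintro rfl i hi
      rw [extendWord_of_lt _ hi]
    · intro h
      funext i
      rw [h i i.2, extendWord_of_lt _ i.2]
  rw [h1, stepLaw, Measure.infinitePi_pi _ fun i _ => measurableSet_singleton _]
  simp

lemma lintegral_wordWeight (g : Ω × (Fin ℓ → R) → ℝ) (n : ℕ) (x : StepGroup R) (ω : Ω) (c : ℝ) :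
    ∫⁻ s, ENNReal.ofReal (Real.exp c * wordWeight g ω x fun i : Fin n => s i) ∂(stepLaw R) =
      ENNReal.ofReal (Real.exp c * wordPartition g n x ω) := by
  rw [lintegral_stepLaw_word n fun w => ENNReal.ofReal (Real.exp c * wordWeight g ω x w)]
  have h1 : ((Fintype.card R : ENNReal)⁻¹) ^ n =
      ENNReal.ofReal (((Fintype.card R : ℝ)⁻¹) ^ n) := by
    rw [ENNReal.ofReal_pow (inv_nonneg.2 card_pos.le), ENNReal.ofReal_inv_of_pos card_pos,
      ENNReal.ofReal_natCast]
  have h2 : ∀ w : Fin n → R, 0 ≤ Real.exp c * wordWeight g ω x w := fun w =>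
    mul_nonneg (Real.exp_pos c).le (wordWeight_nonneg g ω x w)
  rw [← Finset.sum_mul, ← ENNReal.ofReal_sum_of_nonneg fun w _ => h2 w, h1,
    ← ENNReal.ofReal_mul (Finset.sum_nonneg fun w _ => h2 w), wordPartition, ← Finset.mul_sum]
  congr 1
  ring

lemma ptpPartition_bounds (g : Ω × (Fin ℓ → R) → ℝ) (n : ℕ) (x : StepGroup R) (ω : Ω) :
    ENNReal.ofReal (Real.exp (-boundaryBound g (x +ᵥ ω)) * wordPartition g n x ω) ≤
        ptpPartition g ω n x ∧
      ptpPartition g ω n x ≤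
        ENNReal.ofReal (Real.exp (boundaryBound g (x +ᵥ ω)) * wordPartition g n x ω) := by
  have hpos : ∀ s : ℕ → R, position (extendWord fun i : Fin n => s i) n = position s n := fun s =>
    position_congr fun i hi => extendWord_of_lt _ hi
  have hen : ∀ s : ℕ → R, position s n = x →
      |energy g ω n s - energy g ω n (extendWord fun i : Fin n => s i)| ≤
        boundaryBound g (x +ᵥ ω) := fun s hs => by
    rw [← hs]
    exact abs_energy_sub_le g ω fun i hi =>
      (extendWord_of_lt (fun i : Fin n => s i) hi).symm
  rw [← lintegral_wordWeight, ← lintegral_wordWeight]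
  constructor <;> refine lintegral_mono fun s => ?_
  · by_cases hs : position s n = x
    · rw [Set.indicator_of_mem (by exact congrArg Subtype.val hs), wordWeight, hpos, if_pos hs,
        ← Real.exp_add]
      refine ENNReal.ofReal_le_ofReal (Real.exp_le_exp.2 ?_)
      linarith [(abs_le.1 (hen s hs)).1]
    · rw [wordWeight, hpos, if_neg hs, mul_zero, ENNReal.ofReal_zero]
      exact zero_le
  · by_cases hs : position s n = x
    · rw [Set.indicator_of_mem (by exact congrArg Subtype.val hs), wordWeight, hpos, if_pos hs,
        ← Real.exp_add]
      refine ENNReal.ofReal_le_ofReal (Real.exp_le_exp.2 ?_)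
      linarith [(abs_le.1 (hen s hs)).2]
    · rw [Set.indicator_of_notMem (by exact fun h => hs (Subtype.ext h))]
      exact zero_le

lemma exists_ptpFreeEnergy_eq (g : Ω × (Fin ℓ → R) → ℝ) (n : ℕ) (x : StepGroup R) (ω : Ω)
    (h : 0 < wordPartition g n x ω) :
    ∃ r : ℝ, |r - Real.log (wordPartition g n x ω)| ≤ boundaryBound g (x +ᵥ ω) ∧
      ptpFreeEnergy g ω n x = ((r / n : ℝ) : EReal) := by
  obtain ⟨h1, h2⟩ := ptpPartition_bounds g n x ω
  set b := boundaryBound g (x +ᵥ ω)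
  have htop : ptpPartition g ω n x ≠ ⊤ := (h2.trans_lt ENNReal.ofReal_lt_top).ne
  set r := (ptpPartition g ω n x).toReal with hr
  have hr1 : Real.exp (-b) * wordPartition g n x ω ≤ r :=
    (ENNReal.ofReal_le_iff_le_toReal htop).1 h1
  have hr2 : r ≤ Real.exp b * wordPartition g n x ω :=
    ENNReal.toReal_le_of_le_ofReal (by positivity) h2
  have hr0 : 0 < r := lt_of_lt_of_le (by positivity) hr1
  refine ⟨Real.log r, ?_, ?_⟩
  · have l1 := Real.log_le_log (by positivity) hr1
    have l2 := Real.log_le_log hr0 hr2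
    rw [Real.log_mul (Real.exp_pos _).ne' h.ne', Real.log_exp] at l1 l2
    rw [abs_le]
    constructor <;> linarith
  · rw [ptpFreeEnergy, ← ENNReal.ofReal_toReal htop, ← hr, ENNReal.log_ofReal_of_pos hr0,
      EReal.coe_div]
    rfl

end Words

/-! ### Consequences of the class `𝓛` condition -/

section SmallSegments

variable {G Ω ι : Type*} [AddCommGroup G] [AddAction G Ω] {p : AddGroupSeminorm G} {u : ι → G}
  {H H' : Ω → ℝ} {ω : Ω}

lemma SmallSegmentsAt.add (h : SmallSegmentsAt p u H ω) (h' : SmallSegmentsAt p u H' ω) :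
    SmallSegmentsAt p u (fun ω => H ω + H' ω) ω := by
  intro η hη
  obtain ⟨ε, hε, h1⟩ := h (η / 2) (half_pos hη)
  obtain ⟨ε', hε', h2⟩ := h' (η / 2) (half_pos hη)
  refine ⟨min ε ε', lt_min hε hε', ?_⟩
  filter_upwards [h1, h2] with n h1 h2 x hx i hi m hm
  have hnn : (0 : ℝ) ≤ n := Nat.cast_nonneg n
  have h3 := h1 x hx i hi m (hm.trans (mul_le_mul_of_nonneg_right (min_le_left _ _) hnn))
  have h4 := h2 x hx i hi m (hm.trans (mul_le_mul_of_nonneg_right (min_le_right _ _) hnn))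
  rw [Finset.sum_add_distrib]
  linarith

lemma smallSegmentsAt_const {c : ℝ} (hc : 0 ≤ c) : SmallSegmentsAt p u (fun _ : Ω => c) ω := by
  intro η hη
  refine ⟨η / 2 / (c + 1), by positivity, ?_⟩
  filter_upwards [(tendsto_natCast_atTop_atTop.const_mul_atTop (half_pos hη)).eventually_ge_atTop c]
    with n hn x _ i _ m hm
  rw [Finset.sum_const, Finset.card_range, nsmul_eq_mul]
  push_cast
  have h1 : (m : ℝ) * c ≤ η / 2 * n := by
    have h2 : (m : ℝ) * (c + 1) ≤ η / 2 / (c + 1) * n * (c + 1) :=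
      mul_le_mul_of_nonneg_right hm (by positivity)
    have h3 : η / 2 / (c + 1) * n * (c + 1) = η / 2 * n := by field_simp
    have h4 : (0 : ℝ) ≤ m := Nat.cast_nonneg m
    nlinarith
  nlinarith

lemma SmallSegmentsAt.sum {κ : Type*} (s : Finset κ) {f : κ → Ω → ℝ}
    (h : ∀ k ∈ s, SmallSegmentsAt p u (f k) ω) :
    SmallSegmentsAt p u (fun ω => ∑ k ∈ s, f k ω) ω := by
  classical
  induction s using Finset.induction_on with
  | empty => simpa using smallSegmentsAt_const (p := p) (u := u) (ω := ω) le_rfl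
  | insert k s hk ih =>
    simp only [Finset.sum_insert hk]
    exact (h k (Finset.mem_insert_self k s)).add
      (ih fun j hj => h j (Finset.mem_insert_of_mem hj))

lemma SmallSegmentsAt.comp_vadd (h : SmallSegmentsAt p u H ω) (y : G) :
    SmallSegmentsAt p u (fun ω => H (y +ᵥ ω)) ω := by
  intro η hη
  obtain ⟨ε, hε, h1⟩ := h.exists_eventually_le 2 hη
  refine ⟨ε, hε, ?_⟩
  filter_upwards [h1, tendsto_natCast_atTop_atTop.eventually_ge_atTop (p y)]
    with n h1 hn x hx i hi m hm
  have h2 := h1 (y + x) ((map_add_le_add p y x).trans (by linarith)) i hi m hm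
  simpa only [vadd_vadd, add_assoc] using h2

lemma SmallSegmentsAt.congr (h : SmallSegmentsAt p u H ω)
    (hH : ∀ x : G, H (x +ᵥ ω) = H' (x +ᵥ ω)) : SmallSegmentsAt p u H' ω := by
  intro η hη
  obtain ⟨ε, hε, h1⟩ := h η hη
  refine ⟨ε, hε, h1.mono fun n h2 x hx i hi m hm => ?_⟩
  simpa only [hH] using h2 x hx i hi m hm

lemma SmallSegmentsAt.comp {κ : Type*} (h : SmallSegmentsAt p u H ω) (e : κ → ι) :
    SmallSegmentsAt p (fun k => u (e k)) H ω := by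
  intro η hη
  obtain ⟨ε, hε, h1⟩ := h η hη
  exact ⟨ε, hε, h1.mono fun n h2 x hx k hk m hm => h2 x hx (e k) hk m hm⟩

end SmallSegments

section ClassL

variable {d : ℕ} {R : Finset (Fin d → ℤ)} {Ω : Type*} {ℓ : ℕ}

lemma toReal_add (x y : Fin d → ℤ) : toReal (x + y) = toReal x + toReal y := by
  ext i
  simp [toReal]

lemma toReal_neg (x : Fin d → ℤ) : toReal (-x) = -toReal x := by
  ext i
  simp [toReal]

lemma toReal_zero : toReal (0 : Fin d → ℤ) = 0 := by
  ext i
  simp [toReal]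

lemma measurable_totalPotential [MeasurableSpace Ω] {g : Ω × (Fin ℓ → R) → ℝ}
    (hg : ∀ z', Measurable fun ω => g (ω, z')) : Measurable (totalPotential g) :=
  Finset.measurable_fun_sum _ fun z' _ => (hg z').abs

/-- The Euclidean norm on the group of the walk. -/
def groupNorm (R : Finset (Fin d → ℤ)) : AddGroupSeminorm (StepGroup R) where
  toFun x := ‖toReal (x : Fin d → ℤ)‖
  map_zero' := by rw [AddSubgroup.coe_zero, toReal_zero, norm_zero]
  add_le' x y := by
    rw [AddSubgroup.coe_add, toReal_add]
    exact norm_add_le _ _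
  neg' x := by rw [AddSubgroup.coe_neg, toReal_neg, norm_neg]

variable [AddAction (StepGroup R) Ω] {ω : Ω} {H : Ω → ℝ}

/-- If there is a nonzero step, a segment of length zero is a single site; otherwise the group is
trivial and there is only one site. -/
lemma SmallSegmentsAt.sublinearAt
    (h : SmallSegmentsAt (groupNorm R) (fun z : R => step z) H ω) :
    SublinearAt (groupNorm R) H ω := by
  intro η hη
  by_cases hR : ∃ z : R, step z ≠ 0
  · obtain ⟨z, hz⟩ := hR
    obtain ⟨ε, hε, h1⟩ := h η hη
    filter_upwards [h1] with n h1 x hx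
    simpa using h1 x hx z hz 0 (by simp only [Nat.cast_zero]; positivity)
  · push Not at hR
    have htriv : ∀ x : StepGroup R, x = 0 := by
      rintro ⟨x, hx⟩
      have h1 : StepGroup R ≤ ⊥ := (AddSubgroup.closure_le _).2 fun z hz => by
        have h2 := congrArg Subtype.val (hR ⟨z, hz⟩)
        exact h2
      exact Subtype.ext (h1 hx)
    filter_upwards [(tendsto_natCast_atTop_atTop.const_mul_atTop hη).eventually_ge_atTop (H ω)]
      with n hn x _
    rwa [htriv x, zero_vadd]

lemma smallSegmentsAt_stepCost [Nonempty R] {g : Ω × (Fin ℓ → R) → ℝ}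
    (h : ∀ z', SmallSegmentsAt (groupNorm R) (fun z : R => step z) (fun ω => |g (ω, z')|) ω) :
    SmallSegmentsAt (groupNorm R) (fun z : R => step z) (stepCost g) ω := by
  have h1 : SmallSegmentsAt (groupNorm R) (fun z : R => step z) (totalPotential g) ω :=
    SmallSegmentsAt.sum Finset.univ fun z' _ => h z'
  have h2 : SmallSegmentsAt (groupNorm R) (fun z : R => step z) (boundaryBound g) ω := by
    refine SmallSegmentsAt.sum _ fun j _ => SmallSegmentsAt.sum _ fun w _ => ?_
    simp only [two_mul]
    exact (h1.comp_vadd _).add (h1.comp_vadd _)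
  have h0 : 0 ≤ Real.log (Fintype.card R) :=
    Real.log_nonneg (by exact_mod_cast Fintype.card_pos (α := R))
  exact ((smallSegmentsAt_const h0).add h1).add h2

lemma exists_segment_sum_le {f : Ω → ℝ} {z : R}
    (h : limsup (fun ε : ℝ => limsup (fun n : ℕ =>
        ⨆ x : {x : StepGroup R // ‖toReal (x : Fin d → ℤ)‖ ≤ n},
          (∑ k ∈ Finset.range (⌊ε * n⌋₊ + 1), ‖f ((x.1 + k • step z) +ᵥ ω)‖ₑ) / (n : ENNReal))
        atTop) (𝓝[>] (0 : ℝ)) = 0) {η : ℝ} (hη : 0 < η) :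
    ∃ ε > (0 : ℝ), ∀ᶠ n : ℕ in atTop, ∀ x : StepGroup R, groupNorm R x ≤ n →
      ∀ m : ℕ, (m : ℝ) ≤ ε * n →
        ∑ k ∈ Finset.range (m + 1), |f ((x + k • step z) +ᵥ ω)| ≤ η * n := by
  have h1 := eventually_lt_of_limsup_lt (h.trans_lt (ENNReal.ofReal_pos.2 hη))
  obtain ⟨ε, h2, hε⟩ := (h1.and self_mem_nhdsWithin).exists
  refine ⟨ε, hε, ?_⟩
  filter_upwards [eventually_lt_of_limsup_lt h2, eventually_ge_atTop 1] with n h3 hn x hx m hm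
  have hn0 : (0 : ℝ) < n := by exact_mod_cast hn
  have h4 := (le_iSup (fun x : {x : StepGroup R // ‖toReal (x : Fin d → ℤ)‖ ≤ n} =>
    (∑ k ∈ Finset.range (⌊ε * n⌋₊ + 1), ‖f ((x.1 + k • step z) +ᵥ ω)‖ₑ) / (n : ENNReal))
    ⟨x, hx⟩).trans_lt h3
  simp only [Real.enorm_eq_ofReal_abs] at h4
  rw [← ENNReal.ofReal_sum_of_nonneg fun _ _ => abs_nonneg _, ← ENNReal.ofReal_natCast,
    ← ENNReal.ofReal_div_of_pos hn0, ENNReal.ofReal_lt_ofReal_iff hη, div_lt_iff₀ hn0] at h4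
  refine le_trans ?_ h4.le
  refine Finset.sum_le_sum_of_subset_of_nonneg (Finset.range_mono ?_) fun _ _ _ => abs_nonneg _
  exact Nat.add_le_add_right (Nat.le_floor hm) 1

variable [MeasurableSpace Ω] {P : Measure Ω}

lemma InClassL.ae_smallSegmentsAt {g : Ω × (Fin ℓ → R) → ℝ} (hg : InClassL P g) :
    ∀ᵐ ω ∂P, ∀ z', SmallSegmentsAt (groupNorm R) (fun z : R => step z)
      (fun ω => |g (ω, z')|) ω := by
  rw [ae_all_iff]
  intro z'
  have h1 : ∀ᵐ ω ∂P, ∀ z : R, (z : Fin d → ℤ) ≠ 0 → _ := ae_all_iff.2 fun z => by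
    by_cases hz : (z : Fin d → ℤ) ≠ 0
    · exact ((hg z').2 z hz).mono fun ω hω _ => hω
    · exact Eventually.of_forall fun ω h => absurd h hz
  filter_upwards [h1] with ω hω η hη
  have h2 : ∀ z : R, ∃ ε > (0 : ℝ), step z ≠ 0 → ∀ᶠ n : ℕ in atTop, ∀ x : StepGroup R,
      groupNorm R x ≤ n → ∀ m : ℕ, (m : ℝ) ≤ ε * n →
        ∑ k ∈ Finset.range (m + 1), |g ((x + k • step z) +ᵥ ω, z')| ≤ η * n := by
    intro z
    by_cases hz : step z = 0
    · exact ⟨1, one_pos, fun h => absurd hz h⟩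
    · obtain ⟨ε, hε, h3⟩ := exists_segment_sum_le (f := fun ω => g (ω, z'))
        (hω z fun h => hz (Subtype.ext h)) hη
      exact ⟨ε, hε, fun _ => h3⟩
  choose ε hε h3 using h2
  obtain ⟨δ, hδ, hδε⟩ : ∃ δ > (0 : ℝ), ∀ z, δ ≤ ε z := by
    rcases isEmpty_or_nonempty R with hι | hι
    · exact ⟨1, one_pos, fun z => hι.elim z⟩
    · obtain ⟨z, hz⟩ := Finite.exists_min ε
      exact ⟨ε z, hε z, hz⟩
  refine ⟨δ, hδ, ?_⟩
  have h4 : ∀ᶠ n : ℕ in atTop, ∀ z : R, step z ≠ 0 → ∀ x : StepGroup R,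
      groupNorm R x ≤ n → ∀ m : ℕ, (m : ℝ) ≤ ε z * n →
        ∑ k ∈ Finset.range (m + 1), |g ((x + k • step z) +ᵥ ω, z')| ≤ η * n := by
    rw [eventually_all]
    intro z
    by_cases hz : step z = 0
    · exact Eventually.of_forall fun n h => absurd hz h
    · exact (h3 z hz).mono fun n hn _ => hn
  filter_upwards [h4] with n hn x hx z hz m hm
  exact hn z hz x hx m (hm.trans (mul_le_mul_of_nonneg_right (hδε z) (Nat.cast_nonneg n)))

/-! ### Measurability and integrability -/

variable [MeasurableConstVAdd (StepGroup R) Ω]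

lemma measurable_boundaryBound {g : Ω × (Fin ℓ → R) → ℝ}
    (hg : ∀ z', Measurable fun ω => g (ω, z')) : Measurable (boundaryBound g) :=
  Finset.measurable_fun_sum _ fun _ _ => Finset.measurable_fun_sum _ fun _ _ =>
    ((measurable_totalPotential hg).comp (measurable_const_vadd _)).const_mul 2

lemma measurable_stepCost {g : Ω × (Fin ℓ → R) → ℝ}
    (hg : ∀ z', Measurable fun ω => g (ω, z')) : Measurable (stepCost g) :=
  (measurable_const.add (measurable_totalPotential hg)).add (measurable_boundaryBound hg)

lemma measurable_logWordPartition [Nonempty R] {ι : Type*} [Fintype ι] (e : ι → R)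
    {g : Ω × (Fin ℓ → R) → ℝ} (hg : ∀ z', Measurable fun ω => g (ω, z')) (κ : ι → ℕ) :
    Measurable (logWordPartition e g κ) := by
  have h1 : ∀ n x, Measurable (wordPartition g n x) := by
    intro n x
    refine (Finset.measurable_fun_sum _ fun w _ => ?_).const_mul _
    unfold wordWeight
    split_ifs
    · refine Real.measurable_exp.comp (Finset.measurable_fun_sum _ fun k _ => ?_)
      exact (hg _).comp (measurable_const_vadd _)
    · exact measurable_const
  exact (Real.measurable_log.comp (h1 _ _)).sub (measurable_boundaryBound hg)

lemma integrable_stepCost [IsFiniteMeasure P] [VAddInvariantMeasure (StepGroup R) Ω P]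
    {g : Ω × (Fin ℓ → R) → ℝ} (hg : ∀ z', Integrable (fun ω => g (ω, z')) P) :
    Integrable (stepCost g) P := by
  have h1 : Integrable (totalPotential g) P := integrable_finsetSum _ fun z' _ => (hg z').abs
  have h2 : Integrable (boundaryBound g) P :=
    integrable_finsetSum _ fun _ _ => integrable_finsetSum _ fun _ _ =>
      (integrable_comp_vadd h1 _).const_mul 2
  exact ((integrable_const _).add h1).add h2

end ClassL

/-! ### Faces and rounding -/

section Face

variable {d : ℕ} {R : Finset (Fin d → ℤ)} {U₀ : Set (EuclideanSpace ℝ (Fin d))}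
  {ζ : EuclideanSpace ℝ (Fin d)}

/-- The steps that lie in the set `U₀`. -/
abbrev FaceStep (R : Finset (Fin d → ℤ)) (U₀ : Set (EuclideanSpace ℝ (Fin d))) : Type :=
  {z : R // toReal (z : Fin d → ℤ) ∈ U₀}

lemma toReal_injective : Function.Injective (toReal : (Fin d → ℤ) → EuclideanSpace ℝ (Fin d)) := by
  intro x y h
  funext i
  have := congrArg (fun v : EuclideanSpace ℝ (Fin d) => v i) h
  simpa [toReal] using this

lemma toReal_mem_stepHull (z : R) : toReal (z : Fin d → ℤ) ∈ stepHull R :=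
  subset_convexHull ℝ _ ⟨z, z.2, rfl⟩

lemma exists_weights_of_mem_stepHull (h : ζ ∈ stepHull R) :
    ∃ β : R → ℝ, (∀ z, 0 ≤ β z) ∧ ∑ z, β z = 1 ∧ ∑ z : R, β z • toReal (z : Fin d → ℤ) = ζ := by
  classical
  rw [stepHull, ← Finset.coe_image, Finset.mem_convexHull'] at h
  obtain ⟨w, h0, h1, h2⟩ := h
  rw [Finset.sum_image toReal_injective.injOn] at h1 h2
  refine ⟨fun z => w (toReal z), fun z => h0 _ (Finset.mem_image_of_mem _ z.2), ?_, ?_⟩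
  · rw [← h1]
    exact Finset.sum_coe_sort R fun z => w (toReal z)
  · rw [← h2]
    exact Finset.sum_coe_sort R fun z => w (toReal z) • toReal z

/-- Only steps in the face take part in a convex representation of a point of the face. -/
lemma IsFace.toReal_mem_of_weight_ne_zero (hU : IsFace (stepHull R) U₀) (hζ : ζ ∈ U₀) {β : R → ℝ}
    (h0 : ∀ z, 0 ≤ β z) (h1 : ∑ z, β z = 1) (h2 : ∑ z : R, β z • toReal (z : Fin d → ℤ) = ζ)
    {z : R} (hz : β z ≠ 0) : toReal (z : Fin d → ℤ) ∈ U₀ := by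
  classical
  have hz0 : 0 < β z := lt_of_le_of_ne (h0 z) hz.symm
  have e1 : β z + ∑ w ∈ Finset.univ.erase z, β w = 1 := by
    rw [Finset.add_sum_erase _ _ (Finset.mem_univ z), h1]
  have e2 : β z • toReal (z : Fin d → ℤ) +
      ∑ w ∈ Finset.univ.erase z, β w • toReal (w : Fin d → ℤ) = ζ := by
    rw [Finset.add_sum_erase _ (fun w : R => β w • toReal (w : Fin d → ℤ)) (Finset.mem_univ z), h2]
  set S := ∑ w ∈ Finset.univ.erase z, β w with hS
  have hS0 : 0 ≤ S := Finset.sum_nonneg fun w _ => h0 w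
  rcases hS0.eq_or_lt with hS1 | hS1
  · have h3 : ∀ w ∈ Finset.univ.erase z, β w = 0 :=
      (Finset.sum_eq_zero_iff_of_nonneg fun w _ => h0 w).1 hS1.symm
    rw [Finset.sum_eq_zero fun w hw => by rw [h3 w hw, zero_smul], add_zero] at e2
    have h4 : β z = 1 := by linarith
    rw [h4, one_smul] at e2
    rwa [e2]
  · have hy : ∑ w ∈ Finset.univ.erase z, (S⁻¹ * β w) • toReal (w : Fin d → ℤ) ∈ stepHull R := by
      refine (convex_convexHull ℝ _).sum_mem
        (fun w _ => mul_nonneg (inv_nonneg.2 hS0) (h0 w)) ?_ fun w _ => toReal_mem_stepHull w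
      rw [← Finset.mul_sum, ← hS, inv_mul_cancel₀ hS1.ne']
    refine hU.2.left_mem_of_mem_openSegment (toReal_mem_stepHull z) hy hζ
      ⟨β z, S, hz0, hS1, e1, ?_⟩
    rw [← e2, Finset.smul_sum]
    congr 1
    refine Finset.sum_congr rfl fun w _ => ?_
    rw [smul_smul, ← mul_assoc, mul_inv_cancel₀ hS1.ne', one_mul]

lemma sum_eq_sum_face {M : Type*} [AddCommMonoid M]
    [Fintype (FaceStep R U₀)] {f : R → M}
    (hf : ∀ z : R, toReal (z : Fin d → ℤ) ∉ U₀ → f z = 0) :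
    ∑ z, f z = ∑ i : FaceStep R U₀, f i := by
  classical
  rw [← Finset.sum_filter_of_ne (p := fun z : R => toReal (z : Fin d → ℤ) ∈ U₀)
    fun z _ hz => by_contra fun h => hz (hf z h)]
  exact Finset.sum_subtype _ (fun z => by simp) f

/-- A point of the relative interior of a face is a convex combination of the steps in the face with
positive weights: moving a little away from the barycentre of these steps stays in the face. -/
lemma IsFace.exists_pos_weights (hU : IsFace (stepHull R) U₀)
    [Fintype (FaceStep R U₀)] (hζ : ζ ∈ intrinsicInterior ℝ U₀) :
    ∃ α : FaceStep R U₀ → ℝ, (∀ i, 0 < α i) ∧ ∑ i, α i = 1 ∧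
      ∑ i, α i • toReal ((i : R) : Fin d → ℤ) = ζ := by
  obtain ⟨y, hy, hyζ⟩ := mem_intrinsicInterior.1 hζ
  have hζU : ζ ∈ U₀ := intrinsicInterior_subset hζ
  have hne : Nonempty (FaceStep R U₀) := by
    obtain ⟨β, h0, h1, h2⟩ := exists_weights_of_mem_stepHull (hU.2.subset hζU)
    obtain ⟨z, -, hz⟩ := Finset.exists_ne_zero_of_sum_ne_zero (h1.trans_ne one_ne_zero)
    exact ⟨⟨z, hU.toReal_mem_of_weight_ne_zero hζU h0 h1 h2 hz⟩⟩
  set r : ℝ := (Fintype.card (FaceStep R U₀) : ℝ) with hr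
  have hr0 : 0 < r := by rw [hr]; exact_mod_cast Fintype.card_pos
  have hr1 : ∑ _i : FaceStep R U₀, r⁻¹ = 1 := by
    rw [Finset.sum_const, Finset.card_univ, nsmul_eq_mul, ← hr, mul_inv_cancel₀ hr0.ne']
  set c : EuclideanSpace ℝ (Fin d) := ∑ i : FaceStep R U₀, r⁻¹ • toReal ((i : R) : Fin d → ℤ) with hc
  have hcU : c ∈ U₀ := hU.1.sum_mem (fun _ _ => (inv_pos.2 hr0).le) hr1 fun i _ => i.2
  have hζs : ζ ∈ affineSpan ℝ U₀ := subset_affineSpan ℝ _ hζU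
  have hcs : c ∈ affineSpan ℝ U₀ := subset_affineSpan ℝ _ hcU
  set φ : ℝ → affineSpan ℝ U₀ := fun t =>
    ⟨AffineMap.lineMap ζ c (-t), AffineMap.lineMap_mem (-t) hζs hcs⟩ with hφ
  have hφc : Continuous φ :=
    Continuous.subtype_mk (AffineMap.lineMap_continuous.comp continuous_neg) _
  have hφ0 : φ 0 = y := Subtype.ext (by simp [hφ, hyζ])
  have hev : ∀ᶠ t in 𝓝 (0 : ℝ), φ t ∈ interior (Subtype.val ⁻¹' U₀ : Set (affineSpan ℝ U₀)) :=
    hφc.continuousAt.eventually (by rw [hφ0]; exact isOpen_interior.mem_nhds hy)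
  obtain ⟨t, ht, ht0⟩ := ((hev.filter_mono nhdsWithin_le_nhds).and
    (self_mem_nhdsWithin (s := Set.Ioi (0 : ℝ)))).exists
  replace ht0 : 0 < t := ht0
  have htU : AffineMap.lineMap ζ c (-t) ∈ U₀ := (interior_subset ht : φ t ∈ _)
  obtain ⟨β, h0, h1, h2⟩ := exists_weights_of_mem_stepHull (hU.2.subset htU)
  have hβ : ∀ z : R, toReal (z : Fin d → ℤ) ∉ U₀ → β z = 0 := fun z hz =>
    by_contra fun h => hz (hU.toReal_mem_of_weight_ne_zero htU h0 h1 h2 h)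
  rw [sum_eq_sum_face hβ] at h1
  rw [sum_eq_sum_face fun z hz => by rw [hβ z hz, zero_smul]] at h2
  have ht1 : 0 < 1 + t := by linarith
  refine ⟨fun i => (1 + t)⁻¹ * (β i + t * r⁻¹), fun i => ?_, ?_, ?_⟩
  · have := h0 i
    positivity
  · rw [← Finset.mul_sum, Finset.sum_add_distrib, h1, ← Finset.mul_sum, hr1, mul_one,
      inv_mul_cancel₀ ht1.ne']
  · simp only [mul_smul, add_smul, ← Finset.smul_sum, Finset.sum_add_distrib]
    rw [h2, Finset.smul_sum, ← hc, AffineMap.lineMap_apply_module']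
    have : (-t) • (c - ζ) + ζ + t • c = (1 + t) • ζ := by module
    rw [this, smul_smul, inv_mul_cancel₀ ht1.ne', one_smul]

end Face

section Rounding

variable {ι : Type*} [Fintype ι] {d : ℕ}

/-- The deviations of both roundings from `n β` and `n α` are at most one in each entry, and the real
parts cancel because the two weightings of `v` agree. -/
lemma abs_sum_mul_sub_le {α β : ι → ℝ} {k a : ι → ℤ} {n : ℝ} (hk : ∀ i, |(k i : ℝ) - n * β i| ≤ 1)
    (ha : ∀ i, |(a i : ℝ) - n * α i| ≤ 1) {v : ι → ℤ}
    (hv : ∑ i, β i * v i = ∑ i, α i * v i) :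
    |∑ i, (k i - a i) * v i| ≤ 2 * ∑ i, |v i| := by
  have h1 : ((∑ i, (k i - a i) * v i : ℤ) : ℝ) =
      ∑ i, ((k i : ℝ) - n * β i - (a i - n * α i)) * v i := by
    have h2 : ∑ i, n * (β i * v i) = ∑ i, n * (α i * v i) := by
      rw [← Finset.mul_sum, ← Finset.mul_sum, hv]
    push_cast
    have h3 : ∀ i, ((k i : ℝ) - n * β i - (a i - n * α i)) * v i =
        (k i - a i) * v i - n * (β i * v i) + n * (α i * v i) := fun i => by ring
    simp only [h3, Finset.sum_add_distrib, Finset.sum_sub_distrib, h2]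
    ring
  have h2 : |((∑ i, (k i - a i) * v i : ℤ) : ℝ)| ≤ ((2 * ∑ i, |v i| : ℤ) : ℝ) := by
    rw [h1]
    refine (Finset.abs_sum_le_sum_abs _ _).trans ?_
    push_cast
    rw [Finset.mul_sum]
    refine Finset.sum_le_sum fun i _ => ?_
    rw [abs_mul]
    refine mul_le_mul_of_nonneg_right ?_ (abs_nonneg _)
    exact (abs_sub _ _).trans (by linarith [hk i, ha i])
  exact_mod_cast h2

/-- Two roundings of `n β` and `n α`, where `β` and `α` have the same barycentre, have endpoints at
bounded distance, so that only finitely many integer corrections are needed to turn the second into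
step counts with the endpoint of the first. -/
lemma exists_counts_near_of_same_barycentre {α β : ι → ℝ} (hα : ∀ i, 0 < α i)
    (hα1 : ∑ i, α i = 1) (hβ1 : ∑ i, β i = 1) {v : ι → Fin d → ℤ}
    (hv : ∀ j, ∑ i, β i * v i j = ∑ i, α i * v i j) {k : ℕ → ι → ℤ}
    (hk : ∀ n i, |(k n i : ℝ) - n * β i| ≤ 1) :
    ∃ (κ : ℕ → ι → ℕ) (C : ℝ), (∀ n i, |(κ n i : ℝ) - n * α i| ≤ C) ∧
      ∀ᶠ n : ℕ in atTop, ((∑ i, κ n i : ℕ) : ℤ) = ∑ i, k n i ∧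
        ∑ i, κ n i • v i = ∑ i, k n i • v i := by
  set a : ℕ → ι → ℤ := fun n i => ⌊n * α i⌋ with ha
  have hab : ∀ n i, |(a n i : ℝ) - n * α i| ≤ 1 := fun n i => by
    rw [abs_le]
    constructor
    · linarith [Int.lt_floor_add_one ((n : ℝ) * α i)]
    · linarith [Int.floor_le ((n : ℝ) * α i)]
  set D : ℕ → ℤ × (Fin d → ℤ) := fun n =>
    (∑ i, (k n i - a n i), ∑ i, (k n i - a n i) • v i) with hD
  have hfin : (Set.range D).Finite := by
    set M : ℤ := 2 * ∑ i : ι, |(1 : ℤ)| with hM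
    set N : Fin d → ℤ := fun j => 2 * ∑ i, |v i j| with hN
    refine ((Set.finite_Icc (-M) M).prod (Set.finite_Icc (-N) N)).subset ?_
    rintro _ ⟨n, rfl⟩
    have h1 := abs_le.1 (abs_sum_mul_sub_le (hk n) (hab n) (v := fun _ => 1)
      (by simp [hα1, hβ1]))
    have h2 := fun j => abs_le.1 (abs_sum_mul_sub_le (hk n) (hab n) (v := fun i => v i j) (hv j))
    simp only [mul_one] at h1
    refine ⟨h1, ⟨fun j => ?_, fun j => ?_⟩⟩
    · simpa [hD] using (h2 j).1
    · simpa [hD] using (h2 j).2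
  -- A time with the same difference of endpoints as `n`, chosen as a function of that difference:
  -- the correction taken from it then has only finitely many values.
  set f : ℕ → ℕ := fun n => Function.invFun D (D n) with hf
  have hDf : ∀ n, D (f n) = D n := fun n => Function.invFun_eq ⟨n, rfl⟩
  obtain ⟨B, hB⟩ := (hfin.image fun q => ∑ i, |k (Function.invFun D q) i -
    a (Function.invFun D q) i|).bddAbove
  have hfB : ∀ n i, |k (f n) i - a (f n) i| ≤ B := fun n i =>
    (Finset.single_le_sum (f := fun i => |k (f n) i - a (f n) i|) (fun _ _ => abs_nonneg _)
      (Finset.mem_univ i)).trans (hB ⟨D n, ⟨n, rfl⟩, rfl⟩)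
  set K : ℕ → ι → ℤ := fun n i => a n i + (k (f n) i - a (f n) i) with hK
  have hKα : ∀ n i, |(K n i : ℝ) - n * α i| ≤ 1 + B := fun n i => by
    have h1 : (K n i : ℝ) - n * α i = (a n i - n * α i) + ((k (f n) i - a (f n) i : ℤ) : ℝ) := by
      rw [hK]; push_cast; ring
    rw [h1]
    exact (abs_add_le _ _).trans (add_le_add (hab n i) (by exact_mod_cast hfB n i))
  refine ⟨fun n i => (K n i).toNat, 1 + B, fun n i => ?_, ?_⟩
  · have h1 : ((K n i).toNat : ℝ) = max (K n i : ℝ) 0 := by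
      have : (((K n i).toNat : ℤ) : ℝ) = ((max (K n i) 0 : ℤ) : ℝ) := by
        rw [Int.toNat_eq_max]
      rw [Int.cast_max, Int.cast_zero] at this
      exact_mod_cast this
    have h2 : (0 : ℝ) ≤ n * α i := mul_nonneg (Nat.cast_nonneg n) (hα i).le
    have h3 := abs_max_sub_max_le_abs (K n i : ℝ) (n * α i) 0
    rw [max_eq_left h2] at h3
    rw [h1]
    exact h3.trans (hKα n i)
  · have hpos : ∀ᶠ n : ℕ in atTop, ∀ i, 0 ≤ K n i := by
      rw [eventually_all]
      intro i
      filter_upwards [(tendsto_natCast_atTop_atTop.atTop_mul_const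
        (hα i)).eventually_ge_atTop ((1 : ℝ) + B)] with n hn
      have := (abs_le.1 (hKα n i)).1
      exact_mod_cast (by linarith : (0 : ℝ) ≤ K n i)
    filter_upwards [hpos] with n hn
    have hcast : ∀ i, (((K n i).toNat : ℕ) : ℤ) = K n i := fun i => Int.toNat_of_nonneg (hn i)
    have h1 := congrArg Prod.fst (hDf n)
    have h2 := congrArg Prod.snd (hDf n)
    simp only [hD, sub_smul, Finset.sum_sub_distrib] at h1 h2
    constructor
    · push_cast
      simp only [hcast]
      simp only [hK, Finset.sum_add_distrib, Finset.sum_sub_distrib]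
      linarith
    · have h3 : ∑ i, (K n i).toNat • v i = ∑ i, K n i • v i :=
        Finset.sum_congr rfl fun i _ => by rw [← natCast_zsmul, hcast]
      rw [h3]
      simp only [hK, add_smul, sub_smul, Finset.sum_add_distrib, Finset.sum_sub_distrib]
      rw [h2]
      abel

end Rounding

/-! ### The point-to-point free energy -/

lemma tendsto_coe_div_of_abs_sub_le {a b : ℕ → ℝ} {L : EReal}
    (ha : Tendsto (fun n : ℕ => ((a n / n : ℝ) : EReal)) atTop (𝓝 L))
    (hab : ∀ η > 0, ∀ᶠ n : ℕ in atTop, |b n - a n| ≤ η * n) :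
    Tendsto (fun n : ℕ => ((b n / n : ℝ) : EReal)) atTop (𝓝 L) := by
  have h1 : Tendsto (fun n : ℕ => (b n - a n) / n) atTop (𝓝 0) := by
    rw [Metric.tendsto_nhds]
    intro η hη
    filter_upwards [hab (η / 2) (half_pos hη), eventually_ge_atTop 1] with n hn hn1
    have hn0 : (0 : ℝ) < n := by exact_mod_cast hn1
    rw [Real.dist_eq, sub_zero, abs_div, Nat.abs_cast, div_lt_iff₀ hn0]
    nlinarith
  have h2 : Tendsto (fun n : ℕ => (((b n - a n) / n : ℝ) : EReal)) atTop (𝓝 ((0 : ℝ) : EReal)) :=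
    (continuous_coe_real_ereal.tendsto 0).comp h1
  have h3 := (EReal.continuousAt_add (p := (L, ((0 : ℝ) : EReal))) (by simp) (by simp)).tendsto.comp
    (ha.prodMk_nhds h2)
  simp only [EReal.coe_zero, add_zero] at h3
  refine h3.congr fun n => ?_
  simp only [Function.comp_apply]
  rw [← EReal.coe_add]
  congr 1
  ring

lemma coe_displacement {d : ℕ} {R : Finset (Fin d → ℤ)} {ι : Type*} [Fintype ι] (e : ι → R)
    (κ : ι → ℕ) :
    ((displacement (fun i => step (e i)) κ : StepGroup R) : Fin d → ℤ) =
      ∑ i, κ i • ((e i : R) : Fin d → ℤ) := by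
  simp [displacement, step]

section ApproxData

variable {d : ℕ} {R : Finset (Fin d → ℤ)} {U₀ : Set (EuclideanSpace ℝ (Fin d))}
  {ζ : EuclideanSpace ℝ (Fin d)} {β : R → ℝ} {b : ℕ → R → ℤ}

/-- Every admissible approximating sequence of a point of a face has eventually the endpoints of
step counts near `n α`, for any positive weights `α` of that point. -/
lemma IsApproxData.exists_counts [Fintype (FaceStep R U₀)] (hβ : IsApproxData R ζ β b)
    (hU : IsFace (stepHull R) U₀) (hζ : ζ ∈ U₀) {α : FaceStep R U₀ → ℝ} (hα : ∀ i, 0 < α i)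
    (hα1 : ∑ i, α i = 1) (hαζ : ∑ i, α i • toReal ((i : R) : Fin d → ℤ) = ζ) :
    ∃ (κ : ℕ → FaceStep R U₀ → ℕ) (C : ℝ), (∀ n i, |(κ n i : ℝ) - n * α i| ≤ C) ∧
      ∀ᶠ n : ℕ in atTop, ∑ i, κ n i = n ∧
        ((displacement (fun i : FaceStep R U₀ => step (i : R)) (κ n) : StepGroup R) :
          Fin d → ℤ) = xhat β b n := by
  have hβ0 : ∀ z : R, toReal (z : Fin d → ℤ) ∉ U₀ → β z = 0 := fun z hz => by_contra fun h =>
    hz (hU.toReal_mem_of_weight_ne_zero hζ (fun z => (hβ.weight_mem z).1) hβ.weight_sum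
      hβ.weight_repr h)
  have hb0 : ∀ (n : ℕ) (z : R), toReal (z : Fin d → ℤ) ∉ U₀ → ⌊n * β z⌋ + b n z = 0 := fun n z hz => by
    rw [hβ.round_zero n z (hβ0 z hz), hβ0 z hz]
    simp
  have hsum1 : ∑ i : FaceStep R U₀, β i = 1 := by
    rw [← sum_eq_sum_face hβ0, hβ.weight_sum]
  have hsumv : ∑ i : FaceStep R U₀, β i • toReal ((i : R) : Fin d → ℤ) = ζ := by
    rw [← sum_eq_sum_face (f := fun z : R => β z • toReal (z : Fin d → ℤ))
      fun z hz => by rw [hβ0 z hz, zero_smul], hβ.weight_repr]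
  have hround : ∀ (n : ℕ) (i : FaceStep R U₀),
      |((⌊n * β i⌋ + b n i : ℤ) : ℝ) - n * β i| ≤ 1 := by
    intro n i
    have h1 := Int.floor_le ((n : ℝ) * β i)
    have h2 := Int.lt_floor_add_one ((n : ℝ) * β i)
    rw [abs_le]
    push_cast
    rcases hβ.round_mem n i with h | h <;> rw [h] <;> push_cast <;> constructor <;> linarith
  obtain ⟨κ, C, h1, h2⟩ := exists_counts_near_of_same_barycentre hα hα1 hsum1
    (v := fun i : FaceStep R U₀ => ((i : R) : Fin d → ℤ)) (fun j => by
      have h3 := congrArg (fun v : EuclideanSpace ℝ (Fin d) => v j) (hsumv.trans hαζ.symm)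
      simpa [toReal] using h3) (k := fun n i => ⌊n * β i⌋ + b n i) hround
  refine ⟨κ, C, h1, h2.mono fun n hn => ⟨?_, ?_⟩⟩
  · have h3 : ∑ i : FaceStep R U₀, (⌊n * β i⌋ + b n i) = (n : ℤ) := by
      rw [← sum_eq_sum_face (hb0 n), Finset.sum_add_distrib, hβ.round_sum]
      ring
    exact_mod_cast hn.1.trans h3
  · rw [coe_displacement, hn.2, xhat]
    exact (sum_eq_sum_face (f := fun z : R => (⌊n * β z⌋ + b n z) • (z : Fin d → ℤ))
      fun z hz => by rw [hb0 n z hz, zero_smul]).symm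

end ApproxData

section FreeEnergy

variable {d : ℕ} {R : Finset (Fin d → ℤ)} {Ω : Type*} [AddAction (StepGroup R) Ω] {ℓ : ℕ}
  [Nonempty R]

lemma ptpFreeEnergy_congr {g g' : Ω × (Fin ℓ → R) → ℝ} {ω : Ω}
    (h : ∀ (x : StepGroup R) z', g (x +ᵥ ω, z') = g' (x +ᵥ ω, z')) (n : ℕ) (x : Fin d → ℤ) :
    ptpFreeEnergy g ω n x = ptpFreeEnergy g' ω n x := by
  have h1 : energy g ω n = energy g' ω n := funext fun s => Finset.sum_congr rfl fun k _ => h _ _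
  rw [ptpFreeEnergy, ptpFreeEnergy, ptpPartition, ptpPartition, h1]

/-- The free energy along endpoints of step counts near `n α` has the rate of the superadditive
family, because the boundary terms are sublinear. -/
lemma tendsto_ptpFreeEnergy {ι : Type*} [Fintype ι] [DecidableEq ι] (e : ι → R)
    {g : Ω × (Fin ℓ → R) → ℝ} {ω : Ω} (hs : SublinearAt (groupNorm R) (stepCost g) ω)
    {κ : ℕ → ι → ℕ} {α : ι → ℝ} {C : ℝ}
    (hκ : ∀ n i, |(κ n i : ℝ) - n * α i| ≤ C) {x : ℕ → Fin d → ℤ}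
    (hx : ∀ᶠ n : ℕ in atTop, ∑ i, κ n i = n ∧
      ((displacement (fun i => step (e i)) (κ n) : StepGroup R) : Fin d → ℤ) = x n) {L : EReal}
    (hL : Tendsto (fun n : ℕ => ((logWordPartition e g (κ n) ω / n : ℝ) : EReal)) atTop (𝓝 L)) :
    Tendsto (fun n : ℕ => ptpFreeEnergy g ω n (x n)) atTop (𝓝 L) := by
  set D : ℕ → StepGroup R := fun n => displacement (fun i => step (e i)) (κ n) with hD
  choose r hr1 hr2 using fun n : ℕ =>
    exists_ptpFreeEnergy_eq g (∑ i, κ n i) (D n) ω (wordPartition_pos e g (κ n) ω)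
  have hbb : ∀ ω, boundaryBound g ω ≤ stepCost g ω := fun ω => by
    have h0 : 0 ≤ Real.log (Fintype.card R) :=
      Real.log_nonneg (by exact_mod_cast Fintype.card_pos (α := R))
    rw [stepCost]
    linarith [totalPotential_nonneg g ω]
  have hrL : Tendsto (fun n : ℕ => ((r n / n : ℝ) : EReal)) atTop (𝓝 L) := by
    refine tendsto_coe_div_of_abs_sub_le hL fun η hη => ?_
    set S : ℝ := ∑ i, (α i + 1) * groupNorm R (step (e i)) with hS
    filter_upwards [hs.eventually_le S (half_pos hη),
      (tendsto_natCast_atTop_atTop.const_mul_atTop (half_pos hη)).eventually_ge_atTop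
        (boundaryBound g ω),
      tendsto_natCast_atTop_atTop.eventually_ge_atTop C] with n h1 h2 h3
    have hpD : groupNorm R (D n) ≤ S * n := by
      calc groupNorm R (D n) ≤ ∑ i, groupNorm R (κ n i • step (e i)) :=
            Finset.le_sum_of_subadditive (groupNorm R) (map_zero _).le
              (fun a b => map_add_le_add _ a b) _ _
        _ ≤ ∑ i, (α i + 1) * groupNorm R (step (e i)) * n := by
            refine Finset.sum_le_sum fun i _ => (map_nsmul_le_mul _ _ _).trans ?_
            rw [mul_right_comm]
            refine mul_le_mul_of_nonneg_right ?_ (apply_nonneg _ _)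
            have := (abs_le.1 (hκ n i)).2
            linarith
        _ = S * n := by rw [hS, Finset.sum_mul]
    have h4 := hr1 n
    have h5 := (hbb _).trans (h1 (D n) hpD)
    have h6 := boundaryBound_nonneg g ω
    rw [abs_le] at h4 ⊢
    simp only [logWordPartition]
    constructor <;> linarith
  refine hrL.congr' ?_
  filter_upwards [hx] with n hn
  have h1 := hr2 n
  rw [hn.1] at h1
  rw [← h1, ← hn.2]

end FreeEnergy

end RWRP

end

theorem mainTheorem7 {d : ℕ} (R : Finset (Fin d → ℤ)) [Nonempty R]
    {Ω : Type*} [MeasurableSpace Ω] [AddAction (RWRP.StepGroup R) Ω]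
    [MeasurableConstVAdd (RWRP.StepGroup R) Ω]
    (P : Measure Ω) [IsProbabilityMeasure P] [VAddInvariantMeasure (RWRP.StepGroup R) Ω P]
    (ℓ : ℕ) (g : Ω × (Fin ℓ → R) → ℝ) (hg : RWRP.InClassL P g)
    (U₀ : Set (EuclideanSpace ℝ (Fin d))) (hU₀ : RWRP.IsFace (RWRP.stepHull R) U₀)
    (hP : RWRP.ErgodicUnder P
      {z : RWRP.StepGroup R | (z : Fin d → ℤ) ∈ R ∧ RWRP.toReal (z : Fin d → ℤ) ∈ U₀}) :
    ∃ (Λ : EuclideanSpace ℝ (Fin d) → EReal) (Ω₀ : Set Ω),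
      MeasurableSet Ω₀ ∧ P Ω₀ = 1 ∧
      ∀ ζ ∈ intrinsicInterior ℝ U₀,
        ⊥ < Λ ζ ∧
        ∀ (β : R → ℝ) (b : ℕ → R → ℤ), RWRP.IsApproxData R ζ β b →
          ∀ ω ∈ Ω₀,
            Tendsto (fun n : ℕ => RWRP.ptpFreeEnergy g ω n (RWRP.xhat β b n)) atTop (𝓝 (Λ ζ)) := by
  classical
  -- A version of the potential that is measurable for every step block.
  set g' : Ω × (Fin ℓ → R) → ℝ := fun q => (hg q.2).1.1.mk _ q.1 with hg'
  have hg'm : ∀ z', Measurable fun ω => g' (ω, z') := fun z' =>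
    (hg z').1.1.stronglyMeasurable_mk.measurable
  have hg'i : ∀ z', Integrable (fun ω => g' (ω, z')) P := fun z' =>
    (hg z').1.congr (hg z').1.1.ae_eq_mk
  have hgg' : ∀ᵐ ω ∂P, ∀ (x : RWRP.StepGroup R) z', g (x +ᵥ ω, z') = g' (x +ᵥ ω, z') := by
    rw [ae_all_iff]
    intro x
    rw [ae_all_iff]
    intro z'
    exact (measurePreserving_vadd x P).quasiMeasurePreserving.ae (hg z').1.1.ae_eq_mk
  set e : RWRP.FaceStep R U₀ → R := Subtype.val with he
  have hF := RWRP.superadditiveFamily_logWordPartition e g'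
  have hP' : ∀ A : Set Ω, MeasurableSet A →
      (∀ i, (fun ω => RWRP.step (e i) +ᵥ ω) ⁻¹' A = A) → P A = 0 ∨ P A = 1 :=
    fun A hA h => hP A hA fun z hz => h ⟨⟨z, hz.1⟩, hz.2⟩
  have hseg : ∀ᵐ ω ∂P, RWRP.SmallSegmentsAt (RWRP.groupNorm R) (fun z : R => RWRP.step z)
      (RWRP.stepCost g') ω := by
    filter_upwards [hg.ae_smallSegmentsAt, hgg'] with ω h1 h2
    exact RWRP.smallSegmentsAt_stepCost fun z' => (h1 z').congr fun x => by rw [h2]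
  have hsub : ∀ᵐ ω ∂P, RWRP.SublinearAt (RWRP.groupNorm R) (RWRP.stepCost g') ω :=
    hseg.mono fun ω h => h.sublinearAt
  have hrate : ∀ κ : RWRP.FaceStep R U₀ → ℕ, ∃ L : EReal, (∀ i, 1 ≤ κ i) → ⊥ < L ∧
      ∀ᵐ ω ∂P, Tendsto (fun m : ℕ => ((RWRP.logWordPartition e g' (m • κ) ω / m : ℝ) : EReal))
        atTop (𝓝 L) := by
    intro κ
    by_cases hκ : ∀ i, 1 ≤ κ i
    · obtain ⟨L, hL⟩ := hF.exists_tendsto_rate hP' (RWRP.measurable_stepCost hg'm)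
        (RWRP.integrable_stepCost hg'i) (RWRP.measurable_logWordPartition e hg'm) hsub hκ
      exact ⟨L, fun _ => hL⟩
    · exact ⟨0, fun h => absurd h hκ⟩
  choose L hL using hrate
  have hgood : ∀ᵐ ω ∂P, (∀ (x : RWRP.StepGroup R) z', g (x +ᵥ ω, z') = g' (x +ᵥ ω, z')) ∧
      RWRP.SmallSegmentsAt (RWRP.groupNorm R) (fun z : R => RWRP.step z) (RWRP.stepCost g') ω ∧
      ∀ κ : RWRP.FaceStep R U₀ → ℕ, (∀ i, 1 ≤ κ i) →
        Tendsto (fun m : ℕ => ((RWRP.logWordPartition e g' (m • κ) ω / m : ℝ) : EReal))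
          atTop (𝓝 (L κ)) := by
    refine hgg'.and (hseg.and (ae_all_iff.2 fun κ => ?_))
    by_cases hκ : ∀ i, 1 ≤ κ i
    · exact (hL κ hκ).2.mono fun ω h _ => h
    · exact Eventually.of_forall fun ω h => absurd h hκ
  have hpos : ∀ ζ ∈ intrinsicInterior ℝ U₀, ∃ α : RWRP.FaceStep R U₀ → ℝ, (∀ i, 0 < α i) ∧
      ∑ i, α i = 1 ∧ ∑ i, α i • RWRP.toReal ((i : R) : Fin d → ℤ) = ζ :=
    fun ζ hζ => hU₀.exists_pos_weights hζ
  choose! α hα0 hα1 hαζ using hpos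
  have hαle : ∀ ζ ∈ intrinsicInterior ℝ U₀, ∀ i, α ζ i ≤ 1 := fun ζ hζ i => by
    rw [← hα1 ζ hζ]
    exact Finset.single_le_sum (fun j _ => (hα0 ζ hζ j).le) (Finset.mem_univ i)
  obtain ⟨Ω₀, hΩsub, hΩm, hΩ1⟩ : ∃ Ω₀ : Set Ω, (∀ ω ∈ Ω₀,
      (∀ (x : RWRP.StepGroup R) z', g (x +ᵥ ω, z') = g' (x +ᵥ ω, z')) ∧
      RWRP.SmallSegmentsAt (RWRP.groupNorm R) (fun z : R => RWRP.step z) (RWRP.stepCost g') ω ∧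
      ∀ κ : RWRP.FaceStep R U₀ → ℕ, (∀ i, 1 ≤ κ i) →
        Tendsto (fun m : ℕ => ((RWRP.logWordPartition e g' (m • κ) ω / m : ℝ) : EReal))
          atTop (𝓝 (L κ))) ∧ MeasurableSet Ω₀ ∧ P Ω₀ = 1 := by
    obtain ⟨N, hN, hNm, hN0⟩ := exists_measurable_superset_of_null (ae_iff.1 hgood)
    refine ⟨Nᶜ, fun ω hω => by_contra fun h => hω (hN h), hNm.compl, ?_⟩
    rwa [prob_compl_eq_one_iff hNm]
  have hlim : ∀ ζ ∈ intrinsicInterior ℝ U₀, ∀ ω ∈ Ω₀,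
      ∀ (κ : ℕ → RWRP.FaceStep R U₀ → ℕ) (C : ℝ), (∀ n i, |(κ n i : ℝ) - n * α ζ i| ≤ C) →
      ⊥ < RWRP.directionRate L (α ζ) ∧
        Tendsto (fun n : ℕ => ((RWRP.logWordPartition e g' (κ n) ω / n : ℝ) : EReal))
          atTop (𝓝 (RWRP.directionRate L (α ζ))) := by
    intro ζ hζ ω hω κ C hκ
    obtain ⟨-, h2, h3⟩ := hΩsub ω hω
    exact hF.tendsto_directionRate (h2.comp e) (hα0 ζ hζ) (hαle ζ hζ) h3
      (fun κ hκ => (hL κ hκ).1) hκ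
  refine ⟨fun ζ => RWRP.directionRate L (α ζ), Ω₀, hΩm, hΩ1, fun ζ hζ => ⟨?_, ?_⟩⟩
  · have hne : Ω₀.Nonempty := nonempty_of_measure_ne_zero (μ := P) (by rw [hΩ1]; exact one_ne_zero)
    obtain ⟨ω, hω⟩ := hne
    exact (hlim ζ hζ ω hω (fun n i => ⌊n * α ζ i⌋₊) 1 fun n i =>
      RWRP.abs_natFloor_sub_le (mul_nonneg (Nat.cast_nonneg n) (hα0 ζ hζ i).le)).1
  · intro β b hβ ω hω
    obtain ⟨κ, C, hκ, hx⟩ := hβ.exists_counts hU₀ (intrinsicInterior_subset hζ) (hα0 ζ hζ)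
      (hα1 ζ hζ) (hαζ ζ hζ)
    obtain ⟨h1, h2, -⟩ := hΩsub ω hω
    simp only [RWRP.ptpFreeEnergy_congr h1]
    exact RWRP.tendsto_ptpFreeEnergy e h2.sublinearAt hκ hx
      (hlim ζ hζ ω hω κ C hκ).2
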